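/- For a graph $G$ on $n\ge 1$ vertices, let $\vartheta(\overline{G})$ denote the Lovász function of the complement of $G$, that is, the smallest $\kappa>0$ for which there are unit vectors $u_1,\dots,u_n\in\mathbb{R}^n$, with $\langle u_i,u_j\rangle=0$ whenever $ij$ is an edge of $G$, and a unit vector $z\in\mathbb{R}^n$ with $\langle u_i,z\rangle=1/\sqrt{\kappa}$ for all $i$. For an integer $d\ge 0$, let $G_{n,d}$ be a uniformly random simple $d$-regular graph on $n$ labelled vertices, where $nd$ is even; the limits below are taken as $n\to\infty$ along the integers $n$ for which $nd$ is even. **Lemma.** Fix an integer $d\ge 0$ and a real number $\theta\ge 3$. If $\vartheta(\overline{G_{n,d}})\le\theta$ with positive probability, i.e. $\liminf_{n\to\infty}\Pr[\vartheta(\overline{G_{n,d}})\le\theta]>0$, then $\vartheta(\overline{G_{n,d}})\le\theta+1$ with high probability, i.e. $\lim_{n\to\infty}\Pr[\vartheta(\overline{G_{n,d}})\le\theta+1]=1$. -/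

import Mathlib

open Filter Topology

noncomputable section

namespace RandomRegular

/-- An orthogonal representation of a graph on `n` vertices in `ℝⁿ`: unit vectors attached to the
vertices, such that the endpoints of every edge receive orthogonal vectors. -/
structure IsOrthogonalRepresentation {n : ℕ} (G : SimpleGraph (Fin n))
    (u : Fin n → EuclideanSpace ℝ (Fin n)) : Prop where
  unit : ∀ i, ‖u i‖ = 1
  orthogonal : ∀ i j, G.Adj i j → inner ℝ (u i) (u j) = 0

/-- The Lovász function `ϑ(H)`: the smallest `κ > 0` for which the complement of `H` has an
orthogonal representation `u` and there is a unit vector `z` with `⟨u i, z⟩ = 1 / √κ` for all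
vertices `i`. In particular, in `lovaszTheta Gᶜ` the endpoints of the edges of `G` are
orthogonal. -/
def lovaszTheta {n : ℕ} (H : SimpleGraph (Fin n)) : ℝ :=
  sInf {κ : ℝ | 0 < κ ∧ ∃ (u : Fin n → EuclideanSpace ℝ (Fin n)) (z : EuclideanSpace ℝ (Fin n)),
    IsOrthogonalRepresentation Hᶜ u ∧ ‖z‖ = 1 ∧ ∀ i, inner ℝ (u i) z = 1 / √κ}

open Classical in
/-- The finite set of all simple `d`-regular graphs on the vertex set `Fin n`. -/
def regularGraphs (n d : ℕ) : Finset (SimpleGraph (Fin n)) :=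
  Finset.univ.filter fun G => G.IsRegularOfDegree d

open Classical in
/-- The probability that `G_{n,d}`, a uniformly random `d`-regular graph on `Fin n`, has the
property `E`. -/
def probability (n d : ℕ) (E : SimpleGraph (Fin n) → Prop) : ℝ :=
  (((regularGraphs n d).filter E).card : ℝ) / ((regularGraphs n d).card : ℝ)

/-- The limit `n → ∞` along the `n` for which `n * d` is even (for these `n`, once `n > d`,
`d`-regular graphs on `n` vertices exist). -/
def admissible (d : ℕ) : Filter ℕ :=
  atTop ⊓ 𝓟 {n | Even (n * d)}

/-- `G_{n,d}` has the property `E n` with high probability. -/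
def WithHighProbability (d : ℕ) (E : ∀ n : ℕ, SimpleGraph (Fin n) → Prop) : Prop :=
  Tendsto (fun n => probability n d (E n)) (admissible d) (𝓝 1)

/-- `G_{n,d}` has the property `E n` with positive probability. -/
def WithPositiveProbability (d : ℕ) (E : ∀ n : ℕ, SimpleGraph (Fin n) → Prop) : Prop :=
  0 < liminf (fun n => probability n d (E n)) (admissible d)

end RandomRegular

end

/-! In the configuration model a random `d`-regular graph is a uniform bijection σ from edge ends to
half-edges at vertices, conditioned on being simple. Simple configurations have density bounded
below (`exists_fraction_simple`) and every `d`-regular graph comes from equally many of them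
(`card_fibre_eq`). So the set 𝒜 of simple configurations with ϑ ≤ θ has density at least some c > 0.
The Hamming distance to 𝒜 changes by at most 2 under a transposition and vanishes on 𝒜, so a
variance bound (`card_le_of_lipschitz`) makes it less than a small multiple of n, up to density
O(1/n).

A typical σ therefore differs from some τ ∈ 𝒜 at few half-edges, and off a small vertex set W its
graph is contained in that of τ. Typically, too, all small vertex sets span at most 5/4 edges per
vertex (`card_not_sparse_le`). This allows W to be enlarged to a still small set U whose outer
neighbours form an independent set (`IsSparse.exists_isolating`), and makes U 3-colourable. In
`thetaRep_add_one` the vertices neither in U nor adjacent to it keep their vectors from τ, the outer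
neighbours all receive one new direction, which raises the bound by exactly 1, and U receives three
orthonormal vectors built around the old handle. No edge joins U to the vertices that keep their
vectors, so no orthogonality is needed there; three such vectors exist because θ ≥ 3. Restricting
from all to simple configurations costs only a constant factor in the exceptional density. -/

noncomputable section

namespace RandomRegular

/-! ### Concentration of Lipschitz functions on bijections -/

section Concentration
open Finset Equiv

theorem sum_sub_sq_eq {ι : Type*} [Fintype ι] (f : ι → ℝ) (a b : ℝ)
    (ha : ∑ i, f i = Fintype.card ι * a) :
    ∑ i, (f i - b) ^ 2 = ∑ i, (f i - a) ^ 2 + Fintype.card ι * (a - b) ^ 2 := by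
  have h : ∀ i, (f i - b) ^ 2 = (f i - a) ^ 2 + 2 * (a - b) * (f i) + (b ^ 2 - a ^ 2) := by
    intro i; ring
  simp only [h, sum_add_distrib, ← mul_sum, ha, sum_const, card_univ, nsmul_eq_mul]
  ring

theorem decomposeFin_symm_mul {N : ℕ} (p : Fin (N + 1)) (e τ : Perm (Fin N)) :
    Perm.decomposeFin.symm (p, e * τ) =
      Perm.decomposeFin.symm (p, e) * Perm.decomposeFin.symm (0, τ) := by
  ext i
  refine Fin.cases ?_ (fun j => ?_) i <;> simp

theorem decomposeFin_symm_zero_swap {N : ℕ} (a b : Fin N) :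
    Perm.decomposeFin.symm (0, swap a b) = swap a.succ b.succ := by
  ext i
  refine Fin.cases ?_ (fun j => ?_) i
  · rw [swap_apply_of_ne_of_ne (Fin.succ_ne_zero _).symm (Fin.succ_ne_zero _).symm]; simp
  · simp only [Perm.decomposeFin_symm_apply_succ, swap_self, refl_apply]
    rw [← (Fin.succ_injective N).map_swap]

/-- Changing the image of 0 is left multiplication by two transpositions through 0; conjugating by
`σ` moves them to the right, where the Lipschitz hypothesis applies. -/
theorem decomposeFin_symm_change {N : ℕ} (p q : Fin (N + 1)) (e : Perm (Fin N)) :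
    ∃ a b a' b', Perm.decomposeFin.symm (q, e) =
      Perm.decomposeFin.symm (p, e) * swap a b * swap a' b' := by
  set σ := Perm.decomposeFin.symm (p, e) with hσ
  have h1 : Perm.decomposeFin.symm (q, e) = swap 0 q * (swap 0 p * σ) := by
    ext i
    refine Fin.cases ?_ (fun j => ?_) i <;> simp [hσ]
  refine ⟨σ⁻¹ 0, σ⁻¹ q, σ⁻¹ 0, σ⁻¹ p, ?_⟩
  rw [h1, mul_swap_eq_swap_mul σ (σ⁻¹ 0) (σ⁻¹ q), mul_assoc, mul_swap_eq_swap_mul]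
  simp

/-- A function on permutations which changes by at most `L` under a transposition has variance at
most `4 L² N`. -/
theorem sum_sq_sub_mean_perm_le {L : ℝ} (N : ℕ) (f : Perm (Fin N) → ℝ)
    (hf : ∀ σ a b, |f (σ * swap a b) - f σ| ≤ L) (μ : ℝ)
    (hμ : ∑ σ, f σ = Fintype.card (Perm (Fin N)) * μ) :
    ∑ σ, (f σ - μ) ^ 2 ≤ 4 * L ^ 2 * N * Fintype.card (Perm (Fin N)) := by
  induction N generalizing μ with
  | zero =>
    simp only [univ_unique, sum_singleton, Fintype.card_unique] at hμ ⊢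
    simp only [Nat.cast_one, one_mul] at hμ
    simp [← hμ]
  | succ N ih =>
    -- Law of total variance, conditioning on the image of 0. Each fibre is a copy of `Perm (Fin
    -- N)`, covered by induction; the fibre means `ν p` differ by at most 2L, two transpositions
    -- apart, which adds at most 4L².
    have hsum : ∀ g : Perm (Fin (N + 1)) → ℝ,
        ∑ σ, g σ = ∑ p, ∑ e, g (Perm.decomposeFin.symm (p, e)) := by
      intro g
      rw [← Equiv.sum_comp Perm.decomposeFin.symm, Fintype.sum_prod_type]
    have hcard : (Fintype.card (Perm (Fin (N + 1))) : ℝ) =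
        (N + 1) * Fintype.card (Perm (Fin N)) := by
      rw [Fintype.card_congr Perm.decomposeFin, Fintype.card_prod, Fintype.card_fin]
      push_cast; ring
    have hpos : (0 : ℝ) < Fintype.card (Perm (Fin N)) := by exact_mod_cast Fintype.card_pos
    set F : ℝ := (Fintype.card (Perm (Fin N)) : ℝ) with hF
    set ν : Fin (N + 1) → ℝ :=
      fun p => (∑ e, f (Perm.decomposeFin.symm (p, e))) / F with hν
    have hνs : ∀ p, ∑ e, f (Perm.decomposeFin.symm (p, e)) = F * ν p := by
      intro p; rw [hν]; field_simp
    have hdiff : ∀ p q, ν p - ν q ≤ 2 * L := by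
      intro p q
      have : ∑ e, f (Perm.decomposeFin.symm (p, e)) ≤
          ∑ e, (f (Perm.decomposeFin.symm (q, e)) + 2 * L) := by
        refine sum_le_sum fun e _ => ?_
        obtain ⟨a, b, a', b', h⟩ := decomposeFin_symm_change q p e
        rw [h]
        have h1 := (abs_le.1 (hf (Perm.decomposeFin.symm (q, e)) a b)).2
        have h2 := (abs_le.1 (hf (Perm.decomposeFin.symm (q, e) * swap a b) a' b')).2
        linarith
      rw [sum_add_distrib, hνs, hνs, sum_const, card_univ, nsmul_eq_mul, ← hF] at this
      have : F * (ν p - ν q) ≤ F * (2 * L) := by linarith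
      exact le_of_mul_le_mul_left this hpos
    have hmean : ∑ p, ν p = (N + 1) * μ := by
      rw [hsum, hcard] at hμ
      simp only [hνs, ← mul_sum] at hμ
      have : F * ∑ p, ν p = F * ((N + 1) * μ) := by rw [hμ]; ring
      exact mul_left_cancel₀ hpos.ne' this
    have hdev : ∀ p, (ν p - μ) ^ 2 ≤ 4 * L ^ 2 := by
      intro p
      have h1 : ∑ q, (ν p - ν q) ≤ ∑ q : Fin (N + 1), 2 * L := sum_le_sum fun q _ => hdiff p q
      have h2 : ∑ q, (ν q - ν p) ≤ ∑ q : Fin (N + 1), 2 * L := sum_le_sum fun q _ => hdiff q p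
      simp only [sum_sub_distrib, hmean, sum_const, card_univ, Fintype.card_fin, nsmul_eq_mul,
        Nat.cast_add, Nat.cast_one] at h1 h2
      have hN : (0 : ℝ) < N + 1 := by positivity
      have h3 : ν p - μ ≤ 2 * L := by
        refine le_of_mul_le_mul_left ?_ hN; linarith
      have h4 : -(2 * L) ≤ ν p - μ := by
        refine le_of_mul_le_mul_left ?_ hN; linarith
      nlinarith
    rw [hsum, hcard]
    calc ∑ p, ∑ e, (f (Perm.decomposeFin.symm (p, e)) - μ) ^ 2
        ≤ ∑ _p : Fin (N + 1), (4 * L ^ 2 * N * F + F * (4 * L ^ 2)) := by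
          refine sum_le_sum fun p _ => ?_
          rw [sum_sub_sq_eq _ (ν p) μ (hνs p)]
          refine add_le_add (ih (fun e => f (Perm.decomposeFin.symm (p, e))) ?_ _ (hνs p))
            (mul_le_mul_of_nonneg_left (hdev p) hpos.le)
          intro σ a b
          rw [decomposeFin_symm_mul, decomposeFin_symm_zero_swap]
          exact hf _ _ _
      _ = _ := by
          simp only [sum_const, card_univ, Fintype.card_fin, nsmul_eq_mul]
          push_cast; ring

theorem sum_sq_sub_mean_equiv_le {α β : Type*} [Fintype α] [Fintype β] [DecidableEq α]
    [DecidableEq β] {L : ℝ} (f : (α ≃ β) → ℝ)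
    (hf : ∀ σ a b, |f ((swap a b).trans σ) - f σ| ≤ L) (μ : ℝ)
    (hμ : ∑ σ, f σ = Fintype.card (α ≃ β) * μ) :
    ∑ σ, (f σ - μ) ^ 2 ≤ 4 * L ^ 2 * Fintype.card α * Fintype.card (α ≃ β) := by
  rcases isEmpty_or_nonempty (α ≃ β) with h | ⟨⟨e⟩⟩
  · simp
  let e₁ := Fintype.equivFin α
  let T : Perm (Fin (Fintype.card α)) ≃ (α ≃ β) :=
    (equivCongr e₁.symm (e₁.symm.trans e))
  have key := sum_sq_sub_mean_perm_le (L := L) (Fintype.card α) (fun π => f (T π)) ?_ μ ?_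
  · rwa [Equiv.sum_comp T (fun σ => (f σ - μ) ^ 2), Fintype.card_congr T] at key
  · intro π a b
    have : T (π * swap a b) = (swap (e₁.symm a) (e₁.symm b)).trans (T π) := by
      ext x
      simp only [T, equivCongr_apply_apply, trans_apply, Perm.mul_apply, symm_symm]
      rw [e₁.injective.map_swap]; simp
    simp only [this]
    exact hf _ _ _
  · rw [Equiv.sum_comp T f, Fintype.card_congr T, hμ]

/-- If a nonnegative Lipschitz function vanishes on a fraction `c` of all bijections, then it is
small on most of them. -/
theorem card_le_of_lipschitz {α β : Type*} [Fintype α] [Fintype β] [DecidableEq α]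
    [DecidableEq β] {L c t : ℝ} (f : (α ≃ β) → ℝ)
    (hf : ∀ σ a b, |f ((swap a b).trans σ) - f σ| ≤ L) (hc : 0 < c) (ht : 0 < t)
    (hzero : c * Fintype.card (α ≃ β) ≤ #{σ | f σ = 0})
    (hct : 16 * L ^ 2 * Fintype.card α ≤ c * t ^ 2) :
    (#{σ | t ≤ f σ} : ℝ) ≤ 16 * L ^ 2 * Fintype.card α / t ^ 2 * Fintype.card (α ≃ β) := by
  rcases isEmpty_or_nonempty (α ≃ β) with h | h
  · simp
  have hpos : (0 : ℝ) < Fintype.card (α ≃ β) := by exact_mod_cast Fintype.card_pos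
  set M : ℝ := (Fintype.card (α ≃ β) : ℝ) with hM
  set μ : ℝ := (∑ σ, f σ) / M with hμd
  have hμ : ∑ σ, f σ = M * μ := by rw [hμd]; field_simp
  have hV := sum_sq_sub_mean_equiv_le f hf μ hμ
  rw [← hM] at hV
  set V : ℝ := 4 * L ^ 2 * Fintype.card α with hVd
  have hV0 : 0 ≤ V := by positivity
  have hpart : ∀ (p : (α ≃ β) → Prop) [DecidablePred p] (r : ℝ),
      (∀ σ, p σ → r ≤ (f σ - μ) ^ 2) → (#{σ | p σ} : ℝ) * r ≤ V * M := by
    intro p _ r hr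
    calc (#{σ | p σ} : ℝ) * r = ∑ σ with p σ, r := by rw [sum_const, nsmul_eq_mul]
      _ ≤ ∑ σ with p σ, (f σ - μ) ^ 2 := sum_le_sum fun σ hσ => hr σ (mem_filter.1 hσ).2
      _ ≤ ∑ σ, (f σ - μ) ^ 2 :=
        sum_le_sum_of_subset_of_nonneg (filter_subset _ _) fun _ _ _ => sq_nonneg _
      _ ≤ V * M := hV
  -- Chebyshev twice: the zero set is too dense for the mean to exceed t/2, and then values at least
  -- t deviate from the mean by at least t/2.
  have h0 := hpart (fun σ => f σ = 0) (μ ^ 2) (fun σ h => by rw [h]; simp)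
  have hμ2 : c * μ ^ 2 ≤ V := by
    have : (c * μ ^ 2) * M ≤ V * M := by nlinarith [sq_nonneg μ]
    exact le_of_mul_le_mul_right this hpos
  have hμt : 2 * μ ≤ t := by
    have : c * (2 * μ) ^ 2 ≤ c * t ^ 2 := by nlinarith
    have := le_of_mul_le_mul_left this hc
    exact abs_le_of_sq_le_sq' this ht.le |>.2
  have h1 := hpart (fun σ => t ≤ f σ) ((t / 2) ^ 2) (fun σ h => by
    apply pow_le_pow_left₀ (by positivity); linarith)
  have : 16 * L ^ 2 * Fintype.card α / t ^ 2 * M = V * M / (t / 2) ^ 2 := by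
    rw [hVd]; field_simp; ring
  rw [this, le_div_iff₀ (by positivity)]
  exact h1

end Concentration

/-! ### Switchings of half-edges -/

section Switching
open Finset Equiv

/-- The half-edge matched to a given half-edge. -/
def opp {m : ℕ} (x : Fin m × Bool) : Fin m × Bool := (x.1, !x.2)

@[simp] theorem opp_opp {m : ℕ} (x : Fin m × Bool) : opp (opp x) = x := by simp [opp]

theorem opp_ne {m : ℕ} (x : Fin m × Bool) : opp x ≠ x := by
  intro h; simpa [opp] using congrArg Prod.snd h

theorem opp_inj {m : ℕ} {x y : Fin m × Bool} : opp x = opp y ↔ x = y :=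
  ⟨fun h => by rw [← opp_opp x, h, opp_opp], fun h => by rw [h]⟩

/-- The oriented edge issuing from a half-edge, if `s` says at which vertices the half-edges sit. -/
def dartOf {V : Type*} {m : ℕ} (s : Fin m × Bool → V) (x : Fin m × Bool) : V × V :=
  (s x, s (opp x))

/-- A half-edge is bad if it lies in a loop or a multiple edge. -/
def Bad {V : Type*} {m : ℕ} (s : Fin m × Bool → V) (x : Fin m × Bool) : Prop :=
  ∃ z, z ≠ x ∧ dartOf s z = dartOf s x

/-- `v` is an endpoint of the edge of `x`, or a neighbour of one. -/
def Near {V : Type*} {m : ℕ} (s : Fin m × Bool → V) (x : Fin m × Bool) (v : V) : Prop :=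
  v = s x ∨ v = s (opp x) ∨ ∃ z, dartOf s z = (s x, v) ∨ dartOf s z = (s (opp x), v)

/-- Swapping x and y replaces their edges by one from `s y` to `s (opp x)` and one from `s x` to `s
(opp y)`; this condition keeps both from being loops or copies of existing edges. -/
def Far {V : Type*} {m : ℕ} (s : Fin m × Bool → V) (x y : Fin m × Bool) : Prop :=
  ¬ Near s x (s y) ∧ ¬ Near s x (s (opp y))

theorem Far.ne {V : Type*} {m : ℕ} {s : Fin m × Bool → V} {x y : Fin m × Bool}
    (h : Far s x y) : s y ≠ s x ∧ s y ≠ s (opp x) ∧ s (opp y) ≠ s x ∧ s (opp y) ≠ s (opp x) :=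
  ⟨fun e => h.1 (.inl e), fun e => h.1 (.inr (.inl e)), fun e => h.2 (.inl e),
    fun e => h.2 (.inr (.inl e))⟩

theorem bad_opp {V : Type*} {m : ℕ} {s : Fin m × Bool → V} {x : Fin m × Bool}
    (h : Bad s x) : Bad s (opp x) := by
  obtain ⟨z, hz, h⟩ := h
  refine ⟨opp z, fun e => hz (opp_inj.1 e), ?_⟩
  simp only [dartOf, Prod.mk.injEq, opp_opp] at h ⊢
  exact ⟨h.2, h.1⟩

/-- Values of the switched map at the four half-edges concerned and elsewhere. -/
theorem switch_apply {V : Type*} {m : ℕ} {s : Fin m × Bool → V} {x y : Fin m × Bool}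
    (hf : Far s x y) :
    (s ∘ swap x y) x = s y ∧ (s ∘ swap x y) y = s x ∧
    (s ∘ swap x y) (opp x) = s (opp x) ∧ (s ∘ swap x y) (opp y) = s (opp y) := by
  obtain ⟨h1, h2, h3, h4⟩ := hf.ne
  have hxy : opp x ≠ y := fun e => h2 (by rw [e])
  have hyx : opp y ≠ x := fun e => h3 (by rw [e])
  refine ⟨by simp, by simp, ?_, ?_⟩
  · simp [swap_apply_of_ne_of_ne (opp_ne x) hxy]
  · simp [swap_apply_of_ne_of_ne hyx (opp_ne y)]

/-- A twin of the new edge that is untouched by the switch would make `s y` a neighbour of `s (opp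
x)`. Among the switched half-edges `Far` rules out all but `opp y`, which needs the edge of y not to
be a loop. -/
theorem not_bad_switch_left {V : Type*} {m : ℕ} {s : Fin m × Bool → V} {x y : Fin m × Bool}
    (hf : Far s x y) (hy : s y ≠ s (opp y)) : ¬ Bad (s ∘ swap x y) x := by
  obtain ⟨h1, h2, h3, h4⟩ := hf.ne
  obtain ⟨e1, e2, e3, e4⟩ := switch_apply hf
  rintro ⟨z, hz, h⟩
  simp only [dartOf, Prod.mk.injEq, e1, e3] at h
  obtain ⟨ha, hb⟩ := h
  by_cases z1 : z = opp x
  · subst z1; rw [e3] at ha; exact h2 ha.symm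
  by_cases z2 : z = y
  · subst z2; rw [e2] at ha; exact h1 ha.symm
  by_cases z3 : z = opp y
  · subst z3; rw [e4] at ha; exact hy ha.symm
  have w1 : opp z ≠ x := fun e => z1 (by rw [← e, opp_opp])
  have w2 : opp z ≠ y := fun e => z3 (by rw [← e, opp_opp])
  simp only [Function.comp, swap_apply_of_ne_of_ne hz z2, swap_apply_of_ne_of_ne w1 w2] at ha hb
  exact hf.1 (.inr (.inr ⟨opp z, .inr (by simp [dartOf, ha, hb])⟩))

theorem not_bad_switch_right {V : Type*} {m : ℕ} {s : Fin m × Bool → V} {x y : Fin m × Bool}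
    (hf : Far s x y) (hy : s y ≠ s (opp y)) : ¬ Bad (s ∘ swap x y) y := by
  obtain ⟨h1, h2, h3, h4⟩ := hf.ne
  obtain ⟨e1, e2, e3, e4⟩ := switch_apply hf
  rintro ⟨z, hz, h⟩
  simp only [dartOf, Prod.mk.injEq, e2, e4] at h
  obtain ⟨ha, hb⟩ := h
  by_cases z1 : z = opp y
  · subst z1; rw [e4] at ha; exact h3 ha
  by_cases z2 : z = x
  · subst z2; rw [e1] at ha; exact h1 ha
  by_cases z3 : z = opp x
  · subst z3; rw [opp_opp, e1] at hb; exact hy hb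
  have w1 : opp z ≠ y := fun e => z1 (by rw [← e, opp_opp])
  have w2 : opp z ≠ x := fun e => z3 (by rw [← e, opp_opp])
  simp only [Function.comp, swap_apply_of_ne_of_ne z2 hz, swap_apply_of_ne_of_ne w2 w1] at ha hb
  exact hf.2 (.inr (.inr ⟨z, .inl (by simp [dartOf, ha, hb])⟩))

/-- Switching the edge of `x` with a far away edge creates no bad half-edge and repairs `x`. -/
theorem bad_of_bad_switch {V : Type*} {m : ℕ} {s : Fin m × Bool → V} {x y z : Fin m × Bool}
    (hf : Far s x y) (hy : s y ≠ s (opp y)) (hz : Bad (s ∘ swap x y) z) :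
    Bad s z ∧ z ≠ x := by
  have nx := not_bad_switch_left hf hy
  have ny := not_bad_switch_right hf hy
  have nx' : ¬ Bad (s ∘ swap x y) (opp x) := fun h => nx (by simpa using bad_opp h)
  have ny' : ¬ Bad (s ∘ swap x y) (opp y) := fun h => ny (by simpa using bad_opp h)
  -- A half-edge that is bad after the switch is none of the four involved, so its dart is
  -- unchanged. Its twin is bad too, hence also unchanged.
  have key : ∀ w, Bad (s ∘ swap x y) w → dartOf (s ∘ swap x y) w = dartOf s w := by
    intro w hw
    have z1 : w ≠ x := by rintro rfl; exact nx hw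
    have z2 : w ≠ y := by rintro rfl; exact ny hw
    have z3 : opp w ≠ x := by rintro rfl; rw [opp_opp] at nx'; exact nx' hw
    have z4 : opp w ≠ y := by rintro rfl; rw [opp_opp] at ny'; exact ny' hw
    simp [dartOf, swap_apply_of_ne_of_ne z1 z2, swap_apply_of_ne_of_ne z3 z4]
  refine ⟨?_, by rintro rfl; exact nx hz⟩
  obtain ⟨w, hw, h⟩ := hz
  refine ⟨w, hw, ?_⟩
  rw [← key w ⟨z, hw.symm, h.symm⟩, ← key z ⟨w, hw, h⟩, h]

/-- Undoing a switch: the second half-edge is within reach of the first. -/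
theorem reach_of_switch {V : Type*} {m : ℕ} {s : Fin m × Bool → V} {x y : Fin m × Bool}
    (hf : Far s x y) (hx : Bad s x) :
    (s ∘ swap x y) y = (s ∘ swap x y) (opp x) ∨
    ∃ z, (s ∘ swap x y) z = (s ∘ swap x y) (opp x) ∧
      (s ∘ swap x y) y = (s ∘ swap x y) (opp z) := by
  obtain ⟨h1, h2, h3, h4⟩ := hf.ne
  obtain ⟨e1, e2, e3, e4⟩ := switch_apply hf
  obtain ⟨z, hz, h⟩ := hx
  simp only [dartOf, Prod.mk.injEq] at h
  obtain ⟨ha, hb⟩ := h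
  by_cases z1 : z = opp x
  · subst z1; left; rw [e2, e3, ha]
  right
  have z2 : z ≠ y := by rintro rfl; exact h1 ha
  have z3 : z ≠ opp y := by rintro rfl; exact h3 ha
  have w1 : opp z ≠ x := fun e => z1 (by rw [← e, opp_opp])
  have w2 : opp z ≠ y := fun e => z3 (by rw [← e, opp_opp])
  refine ⟨opp z, ?_, ?_⟩
  · rw [e3, ← hb, Function.comp, swap_apply_of_ne_of_ne w1 w2]
  · rw [e2, opp_opp, ← ha, Function.comp, swap_apply_of_ne_of_ne hz z2]

end Switching

/-! ### A positive fraction of configurations is simple -/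

section SimpleProbability
open Finset Equiv

/-- The configuration model: the ends of the `m` edges are matched with the half-edges at the
vertices, `d` of them at each vertex. -/
abbrev Config (n d m : ℕ) := (Fin m × Bool) ≃ (Fin n × Fin d)

variable {n d m : ℕ}

def ends (σ : Config n d m) (x : Fin m × Bool) : Fin n := (σ x).1

theorem ends_swap_trans (σ : Config n d m) (x y : Fin m × Bool) :
    ends ((swap x y).trans σ) = ends σ ∘ swap x y := rfl

theorem card_ends_mem (σ : Config n d m) (B : Finset (Fin n)) :
    #{x | ends σ x ∈ B} = #B * d := by
  have : (univ.filter fun x => ends σ x ∈ B) = (B ×ˢ univ).map σ.symm.toEmbedding := by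
    ext x
    simp only [mem_filter, mem_univ, true_and, mem_map_equiv, symm_symm, mem_product, and_true]
    rfl
  rw [this, card_map, card_product, card_univ, Fintype.card_fin]

theorem card_ends_opp_mem (σ : Config n d m) (B : Finset (Fin n)) :
    #{x | ends σ (opp x) ∈ B} = #B * d := by
  rw [← card_ends_mem σ B]
  refine card_bij (fun x _ => opp x) (by simp) (fun x _ y _ h => opp_inj.1 h) ?_
  intro x hx
  exact ⟨opp x, by simpa using hx, opp_opp x⟩

theorem card_ends_eq (σ : Config n d m) (v : Fin n) : #{x | ends σ x = v} = d := by
  have := card_ends_mem σ {v}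
  simpa using this

open Classical in
theorem card_near_le (σ : Config n d m) (x : Fin m × Bool) :
    #{v | Near (ends σ) x v} ≤ 2 + 2 * d := by
  have hsub : (univ.filter fun v => Near (ends σ) x v) ⊆
      ({ends σ x, ends σ (opp x)} : Finset (Fin n)) ∪
      (({z | ends σ z = ends σ x} : Finset _).image (fun z => ends σ (opp z)) ∪
       ({z | ends σ z = ends σ (opp x)} : Finset _).image (fun z => ends σ (opp z))) := by
    intro v hv
    simp only [Near, dartOf, Prod.mk.injEq, mem_filter, mem_univ, true_and] at hv
    simp only [mem_union, mem_insert, mem_singleton, mem_image, mem_filter, mem_univ, true_and]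
    rcases hv with h | h | ⟨z, ⟨h, h'⟩ | ⟨h, h'⟩⟩
    · exact .inl (.inl h)
    · exact .inl (.inr h)
    · exact .inr (.inl ⟨z, h, h'⟩)
    · exact .inr (.inr ⟨z, h, h'⟩)
  refine (card_le_card hsub).trans ((card_union_le _ _).trans ?_)
  have h1 := (card_image_le (s := ({z | ends σ z = ends σ x} : Finset _))
    (f := fun z => ends σ (opp z))).trans_eq (card_ends_eq σ _)
  have h2 := (card_image_le (s := ({z | ends σ z = ends σ (opp x)} : Finset _))
    (f := fun z => ends σ (opp z))).trans_eq (card_ends_eq σ _)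
  have h3 := card_le_two (a := ends σ x) (b := ends σ (opp x))
  have h4 := card_union_le (({z | ends σ z = ends σ x} : Finset _).image (fun z => ends σ (opp z)))
    (({z | ends σ z = ends σ (opp x)} : Finset _).image (fun z => ends σ (opp z)))
  omega

open Classical in
theorem card_not_far_le (σ : Config n d m) (x : Fin m × Bool) :
    #{y | ¬ Far (ends σ) x y} ≤ 4 * d * (d + 1) := by
  have hsub : (univ.filter fun y => ¬ Far (ends σ) x y) ⊆
      ({y | ends σ y ∈ ({v | Near (ends σ) x v} : Finset _)} : Finset _) ∪
      ({y | ends σ (opp y) ∈ ({v | Near (ends σ) x v} : Finset _)} : Finset _) := by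
    intro y hy
    simp only [mem_filter, mem_univ, true_and, mem_union] at hy ⊢
    by_contra h
    exact hy ⟨fun a => h (.inl a), fun a => h (.inr a)⟩
  refine (card_le_card hsub).trans ((card_union_le _ _).trans ?_)
  rw [card_ends_mem, card_ends_opp_mem]
  nlinarith [Nat.mul_le_mul_right d (card_near_le σ x)]

open Classical in
def badCount (σ : Config n d m) : ℕ := #{x | Bad (ends σ) x}

open Classical in
theorem card_reach_le (σ : Config n d m) (x : Fin m × Bool) :
    #{y | ends σ y = ends σ (opp x) ∨
      ∃ z, ends σ z = ends σ (opp x) ∧ ends σ y = ends σ (opp z)} ≤ d + d ^ 2 := by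
  have hsub : (univ.filter fun y => ends σ y = ends σ (opp x) ∨
      ∃ z, ends σ z = ends σ (opp x) ∧ ends σ y = ends σ (opp z)) ⊆
      ({y | ends σ y = ends σ (opp x)} : Finset _) ∪
      ({z | ends σ z = ends σ (opp x)} : Finset _).biUnion
        (fun z => ({y | ends σ y = ends σ (opp z)} : Finset _)) := by
    intro y hy
    simpa only [mem_filter, mem_univ, true_and, mem_union, mem_biUnion] using hy
  refine (card_le_card hsub).trans ((card_union_le _ _).trans ?_)
  refine add_le_add (card_ends_eq σ _).le ?_
  refine (card_biUnion_le_card_mul _ _ d fun z _ => (card_ends_eq σ _).le).trans ?_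
  rw [card_ends_eq, sq]

open Classical in
/-- Double counting of switches leading from `A` to `B`. -/
theorem sum_badCount_mul_le (A B : Finset (Config n d m)) (M : ℕ)
    (h : ∀ σ ∈ A, ∀ x, Bad (ends σ) x →
      M ≤ #{y | Far (ends σ) x y ∧ (swap x y).trans σ ∈ B}) :
    (∑ σ ∈ A, badCount σ) * M ≤ #B * (2 * m * (d + d ^ 2)) := by
  set T : Finset (Config n d m × (Fin m × Bool) × (Fin m × Bool)) :=
    {t | (t.1 ∈ A ∧ Bad (ends t.1) t.2.1) ∧
      (Far (ends t.1) t.2.1 t.2.2 ∧ (swap t.2.1 t.2.2).trans t.1 ∈ B)} with hT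
  set T' : Finset (Config n d m × (Fin m × Bool) × (Fin m × Bool)) :=
    {t | t.1 ∈ B ∧ (ends t.1 t.2.2 = ends t.1 (opp t.2.1) ∨
      ∃ z, ends t.1 z = ends t.1 (opp t.2.1) ∧ ends t.1 t.2.2 = ends t.1 (opp z))} with hT'
  have h1 : (∑ σ ∈ A, badCount σ) * M ≤ #T := by
    have : #T = ∑ σ, ∑ x, if σ ∈ A ∧ Bad (ends σ) x then
        #{y | Far (ends σ) x y ∧ (swap x y).trans σ ∈ B} else 0 := by
      rw [hT, card_filter, Fintype.sum_prod_type]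
      refine sum_congr rfl fun σ _ => ?_
      rw [Fintype.sum_prod_type]
      refine sum_congr rfl fun x _ => ?_
      by_cases hx : σ ∈ A ∧ Bad (ends σ) x
      · simp only [hx, card_filter]; simp
      · simp [hx]
    rw [this, sum_mul, ← sum_filter_add_sum_filter_not univ (fun σ => σ ∈ A)]
    refine le_trans ?_ (Nat.le_add_right _ _)
    rw [filter_mem_eq_inter, univ_inter]
    refine sum_le_sum fun σ hσ => ?_
    rw [badCount, card_filter, sum_mul]
    refine sum_le_sum fun x _ => ?_
    by_cases hx : Bad (ends σ) x
    · simpa [hσ, hx] using h σ hσ x hx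
    · simp [hx]
  -- Performing the switch while remembering x and y is injective, and badness of x confines y to
  -- the reach of x afterwards.
  have h2 : #T ≤ #T' := by
    refine card_le_card_of_injOn (fun t => ((swap t.2.1 t.2.2).trans t.1, t.2)) ?_ ?_
    · rintro ⟨σ, x, y⟩ ht
      simp only [hT, coe_filter, mem_univ, true_and, Set.mem_ofPred_eq] at ht
      simp only [hT', coe_filter, mem_univ, true_and, Set.mem_ofPred_eq]
      exact ⟨ht.2.2, reach_of_switch ht.2.1 ht.1.2⟩
    · rintro ⟨σ, x, y⟩ _ ⟨σ', x', y'⟩ _ he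
      simp only [Prod.mk.injEq] at he
      obtain ⟨h1, rfl, rfl⟩ := he
      have : σ = σ' := by
        ext1 z
        have := congrArg (fun τ => τ (swap x y z)) h1
        simpa using this
      rw [this]
  have h3 : #T' ≤ #B * (2 * m * (d + d ^ 2)) := by
    have : #T' = ∑ σ, ∑ x, if σ ∈ B then #{y | ends σ y = ends σ (opp x) ∨
      ∃ z, ends σ z = ends σ (opp x) ∧ ends σ y = ends σ (opp z)} else 0 := by
      rw [hT', card_filter, Fintype.sum_prod_type]
      refine sum_congr rfl fun σ _ => ?_
      rw [Fintype.sum_prod_type]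
      refine sum_congr rfl fun x _ => ?_
      by_cases hx : σ ∈ B
      · simp only [hx, card_filter]; simp
      · simp [hx]
    rw [this]
    calc _ ≤ ∑ σ : Config n d m, ∑ _x : Fin m × Bool, if σ ∈ B then d + d ^ 2 else 0 := by
          refine sum_le_sum fun σ _ => sum_le_sum fun x _ => ?_
          split_ifs
          · exact card_reach_le σ x
          · exact le_rfl
      _ = _ := by
          simp only [sum_const, card_univ, Fintype.card_prod, Fintype.card_fin, Fintype.card_bool,
            smul_eq_mul, mul_ite, mul_zero, ← sum_filter, filter_univ_mem]
          ring
  exact h1.trans (h2.trans h3)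

open Classical in
theorem card_far_ge (σ : Config n d m) (x : Fin m × Bool) :
    2 * m ≤ #{y | Far (ends σ) x y} + 4 * d * (d + 1) := by
  have h := card_filter_add_card_filter_not (s := univ) (fun y => Far (ends σ) x y)
  have h' := card_not_far_le σ x
  simp only [card_univ, Fintype.card_prod, Fintype.card_fin, Fintype.card_bool] at h
  omega

/-- At least m switches leave each bad half-edge, while at most 2m(d + d²) lead into any
configuration; this bounds the mean number of bad half-edges. -/
theorem sum_badCount_le (hm : 4 * d * (d + 1) ≤ m) (hm0 : 0 < m) :
    ∑ σ : Config n d m, badCount σ ≤ 2 * (d + d ^ 2) * Fintype.card (Config n d m) := by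
  classical
  have := sum_badCount_mul_le (univ : Finset (Config n d m)) univ m (fun σ _ x _ => by
    have := card_far_ge σ x
    simp only [mem_univ, and_true]
    omega)
  rw [card_univ] at this
  refine Nat.le_of_mul_le_mul_right (this.trans_eq ?_) hm0
  ring

/-- Using only far half-edges y that are not bad loses at most k + 1 choices, and each such switch
strictly lowers the bad count. The factor k + 1 gained on the left is discarded. -/
theorem card_badCount_eq_le (k : ℕ) (hm : 4 * d * (d + 1) + (k + 1) ≤ m) :
    #{σ : Config n d m | badCount σ = k + 1} ≤
      2 * (d + d ^ 2) * #{σ : Config n d m | badCount σ ≤ k} := by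
  classical
  have := sum_badCount_mul_le ({σ : Config n d m | badCount σ = k + 1} : Finset _)
    ({σ : Config n d m | badCount σ ≤ k} : Finset _) m (fun σ hσ x hx => by
      have hσ' : badCount σ = k + 1 := (mem_filter.1 hσ).2
      have h1 := card_far_ge σ x
      have h2 : #{y | Far (ends σ) x y} ≤
          #{y | Far (ends σ) x y ∧ (swap x y).trans σ ∈
            ({σ : Config n d m | badCount σ ≤ k} : Finset _)} + badCount σ := by
        rw [badCount]
        refine (card_le_card ?_).trans (card_union_le _ _)
        intro y hy
        simp only [mem_filter, mem_univ, true_and, mem_union] at hy ⊢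
        by_cases hb : Bad (ends σ) y
        · exact .inr hb
        refine .inl ⟨hy, ?_⟩
        have hloop : ends σ y ≠ ends σ (opp y) := by
          intro e
          refine hb ⟨opp y, opp_ne y, ?_⟩
          simp [dartOf, e]
        have hlt : badCount ((swap x y).trans σ) < badCount σ := by
          rw [badCount, badCount, ends_swap_trans]
          refine card_lt_card ?_
          rw [ssubset_iff_of_subset]
          · refine ⟨x, by simpa using hx, fun h => ?_⟩
            exact (bad_of_bad_switch hy hloop (mem_filter.1 h).2).2 rfl
          · intro z hz
            simp only [mem_filter, mem_univ, true_and] at hz ⊢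
            exact (bad_of_bad_switch hy hloop hz).1
        omega
      omega)
  have hsum : ∑ σ ∈ ({σ : Config n d m | badCount σ = k + 1} : Finset _), badCount σ =
      #{σ : Config n d m | badCount σ = k + 1} * (k + 1) := by
    rw [sum_congr rfl fun σ hσ => (mem_filter.1 hσ).2, sum_const, smul_eq_mul]
  rw [hsum] at this
  have hm0 : 0 < m := by omega
  have h3 : #{σ : Config n d m | badCount σ = k + 1} * (k + 1) ≤
      2 * (d + d ^ 2) * #{σ : Config n d m | badCount σ ≤ k} := by
    refine Nat.le_of_mul_le_mul_right (this.trans_eq ?_) hm0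
    ring
  exact (Nat.le_mul_of_pos_right _ (Nat.succ_pos k)).trans h3

/-- A configuration is simple if it has no loop and no multiple edge. -/
def IsSimple (σ : Config n d m) : Prop := Function.Injective (dartOf (ends σ))

theorem isSimple_of_badCount_eq_zero {σ : Config n d m} (h : badCount σ = 0) : IsSimple σ := by
  classical
  rw [badCount, card_eq_zero, filter_eq_empty_iff] at h
  intro x y hxy
  by_contra hne
  exact h (mem_univ y) ⟨x, hne, hxy⟩

/-- A positive fraction of all configurations is simple. -/
theorem exists_fraction_simple (d : ℕ) (hd : 0 < d) :
    ∃ C m₀ : ℕ, 0 < C ∧ ∀ n m : ℕ, m₀ ≤ m →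
      Fintype.card (Config n d m) ≤ C * Nat.card {σ : Config n d m // IsSimple σ} := by
  classical
  set K := 2 * (d + d ^ 2) with hK
  have hK0 : 0 < K := by positivity
  -- The mean bad count is at most K, so by Markov half of the configurations have at most 2K bad
  -- half-edges; each of the 2K levels down to zero costs a factor 1 + K.
  refine ⟨2 * (1 + K) ^ (2 * K), 4 * d * (d + 1) + 2 * K, by positivity, fun n m hm => ?_⟩
  have hstep : ∀ k ≤ 2 * K, #{σ : Config n d m | badCount σ ≤ k} ≤
      (1 + K) ^ k * #{σ : Config n d m | badCount σ ≤ 0} := by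
    intro k
    induction k with
    | zero => simp
    | succ k ih =>
      intro hk
      have h1 := card_badCount_eq_le (n := n) (d := d) (m := m) k (by omega)
      have h2 : #{σ : Config n d m | badCount σ ≤ k + 1} ≤
          #{σ : Config n d m | badCount σ ≤ k} + #{σ : Config n d m | badCount σ = k + 1} := by
        refine (card_le_card ?_).trans (card_union_le _ _)
        intro σ hσ
        simp only [mem_filter, mem_univ, true_and, mem_union] at hσ ⊢
        omega
      have h3 := Nat.mul_le_mul_left (1 + K) (ih (by omega))
      rw [← hK] at h1
      calc _ ≤ (1 + K) * #{σ : Config n d m | badCount σ ≤ k} := by linarith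
        _ ≤ _ := h3.trans_eq (by ring)
  have hmarkov : #{σ : Config n d m | ¬ badCount σ ≤ 2 * K} * 2 ≤
      Fintype.card (Config n d m) := by
    have h1 := sum_badCount_le (n := n) (d := d) (m := m) (by omega) (by omega)
    have h2 : #{σ : Config n d m | ¬ badCount σ ≤ 2 * K} * (2 * K) ≤
        ∑ σ : Config n d m, badCount σ := by
      rw [← smul_eq_mul, ← sum_const]
      refine (sum_le_sum fun σ hσ => ?_).trans (sum_le_sum_of_subset (filter_subset _ _))
      have := (mem_filter.1 hσ).2
      omega
    refine Nat.le_of_mul_le_mul_left ?_ hK0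
    calc _ = #{σ : Config n d m | ¬ badCount σ ≤ 2 * K} * (2 * K) := by ring
      _ ≤ _ := h2.trans h1
  have hsplit := card_filter_add_card_filter_not (s := univ)
    (fun σ : Config n d m => badCount σ ≤ 2 * K)
  rw [card_univ] at hsplit
  have hzero : #{σ : Config n d m | badCount σ ≤ 0} ≤ Nat.card {σ : Config n d m // IsSimple σ} := by
    rw [Nat.card_eq_fintype_card, Fintype.card_subtype]
    refine card_le_card fun σ hσ => ?_
    simp only [mem_filter, mem_univ, true_and, Nat.le_zero] at hσ ⊢
    exact isSimple_of_badCount_eq_zero hσ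
  have h4 := (hstep (2 * K) le_rfl).trans (Nat.mul_le_mul_left _ hzero)
  calc Fintype.card (Config n d m) ≤ 2 * #{σ : Config n d m | badCount σ ≤ 2 * K} := by omega
    _ ≤ 2 * ((1 + K) ^ (2 * K) * Nat.card {σ : Config n d m // IsSimple σ}) :=
      Nat.mul_le_mul_left _ h4
    _ = _ := by ring

end SimpleProbability

/-! ### Small vertex sets span few edges -/

section Sparsity
open Finset Equiv

/-- Induction on Y. Given that Y lands in T, exactly |T| − |Y| of the other |α| − |Y| points do too,
and by transposition symmetry each is equally likely; (|T| − |Y|)/(|α| − |Y|) ≤ |T|/|α|. -/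
theorem card_mapsTo_mul_le_aux {α β : Type*} [Fintype α] [Fintype β] [DecidableEq α]
    [DecidableEq β]
    (T : Finset β) (Y : Finset α) :
    (#{σ : α ≃ β | ∀ x ∈ Y, σ x ∈ T} : ℝ) * (Fintype.card α : ℝ) ^ #Y ≤
      (#T : ℝ) ^ #Y * Fintype.card (α ≃ β) := by
  induction Y using Finset.induction_on with
  | empty => simp [card_univ]
  | insert y Y hy ih =>
    set a := #{σ : α ≃ β | ∀ x ∈ Y, σ x ∈ T} with ha
    set a' := #{σ : α ≃ β | ∀ x ∈ insert y Y, σ x ∈ T} with ha'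
    rcases Nat.eq_zero_or_pos a with h0 | hpos
    · have : a' = 0 := by
        rw [ha', card_eq_zero, filter_eq_empty_iff]
        rw [ha, card_eq_zero, filter_eq_empty_iff] at h0
        exact fun σ hσ h => h0 hσ fun x hx => h x (mem_insert_of_mem hx)
      rw [this]; simp; positivity
    have hsym : ∀ z ∉ Y, #{σ : α ≃ β | (∀ x ∈ Y, σ x ∈ T) ∧ σ z ∈ T} = a' := by
      intro z hz
      have hfix : ∀ x ∈ Y, swap y z x = x := fun x hx =>
        swap_apply_of_ne_of_ne (fun h => hy (h ▸ hx)) (fun h => hz (h ▸ hx))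
      rw [ha']
      refine card_bij (fun σ _ => (swap y z).trans σ) ?_ ?_ ?_
      · intro σ hσ
        simp only [mem_filter, mem_univ, true_and, mem_insert, forall_eq_or_imp, trans_apply,
          swap_apply_left] at hσ ⊢
        exact ⟨hσ.2, fun x hx => by rw [hfix x hx]; exact hσ.1 x hx⟩
      · intro σ _ τ _ h
        ext1 x
        have := congrArg (fun ρ => ρ (swap y z x)) h
        simpa using this
      · intro σ hσ
        simp only [mem_filter, mem_univ, true_and, mem_insert, forall_eq_or_imp] at hσ
        refine ⟨(swap y z).trans σ, ?_, ?_⟩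
        · simp only [mem_filter, mem_univ, true_and, trans_apply, swap_apply_right]
          exact ⟨fun x hx => by rw [hfix x hx]; exact hσ.2 x hx, hσ.1⟩
        · ext1 x; simp
    have hcount : #Yᶜ * a' = ∑ σ with (∀ x ∈ Y, σ x ∈ T), #{z ∈ Yᶜ | (σ : α ≃ β) z ∈ T} := by
      calc #Yᶜ * a' = ∑ z ∈ Yᶜ, #{σ : α ≃ β | (∀ x ∈ Y, σ x ∈ T) ∧ σ z ∈ T} := by
            rw [sum_congr rfl fun z hz => hsym z (mem_compl.1 hz), sum_const, smul_eq_mul]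
        _ = ∑ z ∈ Yᶜ, ∑ σ with (∀ x ∈ Y, (σ : α ≃ β) x ∈ T), if σ z ∈ T then 1 else 0 := by
            refine sum_congr rfl fun z _ => ?_
            rw [← filter_filter, card_filter]
        _ = _ := by
            rw [sum_comm]
            exact sum_congr rfl fun σ _ => (card_filter _ _).symm
    have hin : ∀ σ : α ≃ β, (∀ x ∈ Y, σ x ∈ T) → #{z ∈ Yᶜ | σ z ∈ T} + #Y = #T := by
      intro σ hσ
      have h1 : #{z | σ z ∈ T} = #T := by
        rw [← card_map σ.symm.toEmbedding]
        congr 1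
        ext x
        simp [mem_map_equiv]
      rw [← h1, ← card_filter_add_card_filter_not (s := ({z | σ z ∈ T} : Finset α))
        (fun z => z ∈ Yᶜ), filter_filter, filter_filter]
      congr 1
      · congr 1; ext z; simp [and_comm]
      · congr 1; ext z; simp only [mem_filter, mem_univ, true_and, mem_compl, not_not]
        exact ⟨fun h => ⟨hσ z h, h⟩, fun h => h.2⟩
    obtain ⟨σ₀, hσ₀⟩ := card_pos.1 hpos
    have hσ₀' := hin σ₀ (mem_filter.1 hσ₀).2
    have hcount' : (#Yᶜ : ℝ) * a' = a * ((#T : ℝ) - #Y) := by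
      have : #Yᶜ * a' = a * #{z ∈ Yᶜ | σ₀ z ∈ T} := by
        rw [hcount, ha, ← smul_eq_mul, ← sum_const]
        refine sum_congr rfl fun σ hσ => ?_
        have := hin σ (mem_filter.1 hσ).2
        omega
      have h2 : (#T : ℝ) - #Y = #{z ∈ Yᶜ | σ₀ z ∈ T} := by
        rw [← hσ₀']; push_cast; ring
      rw [h2]; exact_mod_cast this
    have hYc : (#Yᶜ : ℝ) = Fintype.card α - #Y := by
      rw [card_compl, Nat.cast_sub (card_le_univ _)]
    have hYpos : (0 : ℝ) < Fintype.card α - #Y := by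
      rw [← hYc]
      exact_mod_cast card_pos.2 ⟨y, mem_compl.2 hy⟩
    have hTN : (#T : ℝ) ≤ Fintype.card α := by
      rw [Fintype.card_congr σ₀]; exact_mod_cast card_le_univ _
    have hstep : (a' : ℝ) * Fintype.card α ≤ a * #T := by
      rw [hYc] at hcount'
      refine le_of_mul_le_mul_left ?_ hYpos
      have : ((Fintype.card α : ℝ) - #Y) * (a' * Fintype.card α) =
          a * ((#T : ℝ) - #Y) * Fintype.card α := by rw [← hcount']; ring
      rw [this]
      have h1 : (0 : ℝ) ≤ a * (#Y * (Fintype.card α - #T)) := by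
        have : (0 : ℝ) ≤ Fintype.card α - #T := by linarith
        positivity
      nlinarith
    rw [card_insert_of_notMem hy, pow_succ, pow_succ]
    calc (a' : ℝ) * ((Fintype.card α : ℝ) ^ #Y * Fintype.card α)
        = (a' * Fintype.card α) * (Fintype.card α : ℝ) ^ #Y := by ring
      _ ≤ (a * #T) * (Fintype.card α : ℝ) ^ #Y := by gcongr
      _ = (a * (Fintype.card α : ℝ) ^ #Y) * #T := by ring
      _ ≤ ((#T : ℝ) ^ #Y * Fintype.card (α ≃ β)) * #T := by gcongr
      _ = _ := by ring

/-- A uniformly random bijection maps `Y` into `T` with probability at most `(|T| / |α|) ^ |Y|`. -/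
theorem card_mapsTo_mul_le {α β : Type*} [Fintype α] [Fintype β] [DecidableEq α] [DecidableEq β]
    (T : Finset β) (Y : Finset α) (A : Finset (α ≃ β)) (hA : ∀ σ ∈ A, ∀ x ∈ Y, σ x ∈ T) :
    (#A : ℝ) * (Fintype.card α : ℝ) ^ #Y ≤ (#T : ℝ) ^ #Y * Fintype.card (α ≃ β) := by
  classical
  refine le_trans ?_ ((card_mapsTo_mul_le_aux T Y).trans_eq ?_)
  · gcongr
    exact fun σ hσ => mem_filter.2 ⟨mem_univ _, hA σ hσ⟩
  · rfl

variable {n d m : ℕ}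

/-- The number of edges of the configuration inside `S`. -/
def edgesInside (σ : Config n d m) (S : Finset (Fin n)) : ℕ :=
  #{i : Fin m | ends σ (i, false) ∈ S ∧ ends σ (i, true) ∈ S}

open Classical in
-- Union bound over S and over k-sets of edges: the 2k ends must all land among the sd half-edges at
-- S.
theorem card_exists_edgesInside_le (hN : n * d = 2 * m) (hd : 0 < d) (s k : ℕ) :
    (#{σ : Config n d m | ∃ S : Finset (Fin n), #S = s ∧ k ≤ edgesInside σ S} : ℝ) ≤
      (n.choose s * m.choose k * ((s : ℝ) / n) ^ (2 * k)) * Fintype.card (Config n d m) := by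
  set P := powersetCard s (univ : Finset (Fin n)) ×ˢ powersetCard k (univ : Finset (Fin m)) with hP
  have hsub : (univ.filter fun σ : Config n d m =>
      ∃ S : Finset (Fin n), #S = s ∧ k ≤ edgesInside σ S) ⊆
      P.biUnion fun p => univ.filter fun σ : Config n d m =>
        ∀ x ∈ p.2 ×ˢ (univ : Finset Bool), σ x ∈ p.1 ×ˢ (univ : Finset (Fin d)) := by
    intro σ hσ
    obtain ⟨S, hS, hk⟩ := (mem_filter.1 hσ).2
    obtain ⟨I, hI, hIk⟩ := exists_subset_card_eq hk
    rw [mem_biUnion]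
    refine ⟨(S, I), by simp [hP, mem_powersetCard, hS, hIk], ?_⟩
    rw [mem_filter]
    refine ⟨mem_univ _, ?_⟩
    rintro ⟨i, b⟩ hi
    have := (mem_filter.1 (hI (mem_product.1 hi).1)).2
    refine mem_product.2 ⟨?_, mem_univ _⟩
    cases b
    · exact this.1
    · exact this.2
  have hone : ∀ p ∈ P, (#(univ.filter fun σ : Config n d m =>
        ∀ x ∈ p.2 ×ˢ (univ : Finset Bool), σ x ∈ p.1 ×ˢ (univ : Finset (Fin d))) : ℝ) ≤
        ((s : ℝ) / n) ^ (2 * k) * Fintype.card (Config n d m) := by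
    intro p hp
    simp only [hP, mem_product, mem_powersetCard, subset_univ, true_and] at hp
    have h := card_mapsTo_mul_le (p.1 ×ˢ (univ : Finset (Fin d))) (p.2 ×ˢ (univ : Finset Bool))
      (univ.filter fun σ : Config n d m => ∀ x ∈ p.2 ×ˢ (univ : Finset Bool),
        σ x ∈ p.1 ×ˢ (univ : Finset (Fin d))) fun σ hσ => (mem_filter.1 hσ).2
    rw [card_product, card_product, hp.1, hp.2, card_univ, card_univ, Fintype.card_fin,
      Fintype.card_bool, Fintype.card_prod, Fintype.card_fin, Fintype.card_bool] at h
    rcases Nat.eq_zero_or_pos k with rfl | hk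
    · rw [zero_mul, pow_zero, mul_one, pow_zero] at h
      rwa [mul_zero, pow_zero]
    have hm : 0 < m := by
      have := card_le_univ p.2
      rw [hp.2, Fintype.card_fin] at this
      omega
    have hn : 0 < n := by
      rcases Nat.eq_zero_or_pos n with rfl | h
      · omega
      · exact h
    have hN' : ((m * 2 : ℕ) : ℝ) = n * d := by rw [mul_comm m 2, ← hN]; push_cast; ring
    rw [hN', mul_comm k 2] at h
    have hd' : (0 : ℝ) < d := by exact_mod_cast hd
    have hn' : (0 : ℝ) < n := by exact_mod_cast hn
    have hfrac : ((s : ℝ) / n) = (s * d : ℕ) / (n * d) := by push_cast; field_simp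
    rw [hfrac, div_pow, div_mul_eq_mul_div, le_div_iff₀ (by positivity)]
    exact h
  calc _ ≤ (#(P.biUnion fun p => univ.filter fun σ : Config n d m =>
        ∀ x ∈ p.2 ×ˢ (univ : Finset Bool), σ x ∈ p.1 ×ˢ (univ : Finset (Fin d))) : ℝ) := by
        exact_mod_cast card_le_card hsub
    _ ≤ ∑ p ∈ P, (#(univ.filter fun σ : Config n d m =>
        ∀ x ∈ p.2 ×ˢ (univ : Finset Bool), σ x ∈ p.1 ×ˢ (univ : Finset (Fin d))) : ℝ) := by
        exact_mod_cast card_biUnion_le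
    _ ≤ ∑ _p ∈ P, ((s : ℝ) / n) ^ (2 * k) * Fintype.card (Config n d m) := sum_le_sum hone
    _ = _ := by
        rw [sum_const, hP, card_product, card_powersetCard, card_powersetCard, card_univ,
          card_univ, Fintype.card_fin, Fintype.card_fin, nsmul_eq_mul]
        push_cast; ring

theorem choose_le_three_mul_div_pow (n s : ℕ) : (n.choose s : ℝ) ≤ (3 * n / s) ^ s := by
  rcases Nat.eq_zero_or_pos s with rfl | hs
  · simp
  have hs' : (0 : ℝ) < s := by exact_mod_cast hs
  have h1 : (n.choose s : ℝ) ≤ (n : ℝ) ^ s / s.factorial := Nat.choose_le_pow_div s n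
  have h2 : (s : ℝ) ^ s / s.factorial ≤ 3 ^ s := by
    refine (Real.pow_div_factorial_le_exp (s : ℝ) hs'.le s).trans ?_
    rw [← mul_one (s : ℝ), Real.exp_nat_mul]
    exact pow_le_pow_left₀ (Real.exp_pos _).le (Real.exp_one_lt_d9.le.trans (by norm_num)) _
  have hf : (0 : ℝ) < s.factorial := by exact_mod_cast s.factorial_pos
  calc (n.choose s : ℝ) ≤ (n : ℝ) ^ s / s.factorial := h1
    _ = ((n : ℝ) / s) ^ s * ((s : ℝ) ^ s / s.factorial) := by
      rw [div_pow]; field_simp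
    _ ≤ ((n : ℝ) / s) ^ s * 3 ^ s := by gcongr
    _ = _ := by rw [← mul_pow]; ring

theorem sum_range_div_two_pow_le (M : ℕ) : ∑ s ∈ range M, (s : ℝ) / 2 ^ s ≤ 2 := by
  have : ∀ M : ℕ, ∑ s ∈ range M, (s : ℝ) / 2 ^ s = 2 - 2 * (M + 1) / 2 ^ M := by
    intro M
    induction M with
    | zero => simp
    | succ M ih => rw [sum_range_succ, ih, pow_succ]; push_cast; field_simp; ring
  rw [this]
  have : (0 : ℝ) ≤ 2 * (M + 1) / 2 ^ M := by positivity
  linarith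

/-- `s + (s / 4 + 1)` is the least e with 5s < 4e. With r = s/n and j = s/4, the powers of r cancel
down to r^(j+1), and s ≤ 4(j + 1) lets (3⁹d⁵)^(j+1) absorb the constants. One factor 3⁹d⁵r yields
the 1/n; the other j, each at most 1/16, yield 8/2^s. -/
theorem unionBound_term_le (hN : n * d = 2 * m) (hd : 0 < d) {s : ℕ} (hs : 0 < s)
    (hsn : 16 * (3 ^ 9 * d ^ 5) * s ≤ n) :
    (n.choose s * m.choose (s + (s / 4 + 1)) * ((s : ℝ) / n) ^ (2 * (s + (s / 4 + 1))) : ℝ) ≤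
      8 * (3 ^ 9 * d ^ 5) / n * (s / 2 ^ s) := by
  set j := s / 4 with hj
  have hs' : (0 : ℝ) < s := by exact_mod_cast hs
  have hd1 : (1 : ℝ) ≤ d := by exact_mod_cast hd
  have hn : 0 < n := by
    refine lt_of_lt_of_le ?_ hsn
    positivity
  have hn' : (0 : ℝ) < n := by exact_mod_cast hn
  set C : ℝ := 3 ^ 9 * d ^ 5 with hC
  have hC1 : 0 < C := by positivity
  set r : ℝ := s / n with hr
  have hr0 : 0 < r := by positivity
  have h1 : (n.choose s : ℝ) ≤ (3 / r) ^ s := by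
    refine (choose_le_three_mul_div_pow n s).trans_eq ?_
    rw [hr]; congr 1; field_simp
  have h2 : (m.choose (s + (j + 1)) : ℝ) ≤ (3 * d / r) ^ (s + (j + 1)) := by
    refine (choose_le_three_mul_div_pow m _).trans (pow_le_pow_left₀ (by positivity) ?_ _)
    have hm : (2 : ℝ) * m = n * d := by exact_mod_cast hN.symm
    have hm' : (m : ℝ) ≤ n * d := by
      have : (0 : ℝ) ≤ m := by positivity
      linarith
    rw [hr]
    calc 3 * (m : ℝ) / ((s + (j + 1) : ℕ) : ℝ) ≤ 3 * (n * d) / s := by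
          gcongr; omega
      _ = _ := by field_simp
  have hCr : C * r ≤ 1 / 16 := by
    have : (16 : ℝ) * C * s ≤ n := by rw [hC]; exact_mod_cast hsn
    rw [hr, ← mul_div_assoc, div_le_iff₀ hn']
    linarith
  have h3 : (3 : ℝ) ^ s * (3 * d) ^ (s + (j + 1)) ≤ C ^ (j + 1) := by
    have : C ^ (j + 1) = 3 ^ (4 * (j + 1)) * (3 * d : ℝ) ^ (4 * (j + 1) + (j + 1)) := by
      rw [hC, pow_mul, show 4 * (j + 1) + (j + 1) = 5 * (j + 1) by ring, pow_mul (3 * d : ℝ),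
        ← mul_pow]
      congr 1; ring
    rw [this]
    gcongr
    · norm_num
    · omega
    · linarith
    · omega
  have h4 : (2 : ℝ) ^ s ≤ 8 * 16 ^ j := by
    calc (2 : ℝ) ^ s ≤ 2 ^ (3 + 4 * j) := pow_le_pow_right₀ (by norm_num) (by omega)
      _ = _ := by rw [pow_add, pow_mul]; norm_num
  calc (n.choose s * m.choose (s + (j + 1)) * r ^ (2 * (s + (j + 1))) : ℝ)
      ≤ (3 / r) ^ s * (3 * d / r) ^ (s + (j + 1)) * r ^ (2 * (s + (j + 1))) := by gcongr
    _ = (3 ^ s * (3 * d) ^ (s + (j + 1))) * r ^ (j + 1) := by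
      clear_value r
      rw [div_pow, div_pow, show 2 * (s + (j + 1)) = s + (s + (j + 1)) + (j + 1) by ring,
        pow_add r (s + (s + (j + 1))), pow_add r s]
      field_simp
      ring
    _ ≤ C ^ (j + 1) * r ^ (j + 1) := by gcongr
    _ = (C * r) * (C * r) ^ j := by rw [← mul_pow, pow_succ']
    _ ≤ (C * r) * (1 / 16) ^ j := by gcongr
    _ ≤ (C * r) * (8 / 2 ^ s) := by
      gcongr
      rw [div_pow, one_pow, div_le_div_iff₀ (by positivity) (by positivity)]
      linarith
    _ = _ := by rw [hr]; field_simp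

open Classical in
/-- Small vertex sets of a random configuration span few edges. -/
theorem card_not_sparse_le (hN : n * d = 2 * m) (hd : 0 < d) :
    (#{σ : Config n d m | ∃ S : Finset (Fin n), 16 * (3 ^ 9 * d ^ 5) * #S ≤ n ∧
      5 * #S < 4 * edgesInside σ S} : ℝ) ≤
      16 * (3 ^ 9 * d ^ 5) / n * Fintype.card (Config n d m) := by
  set Q := (range (n + 1)).filter fun s => 0 < s ∧ 16 * (3 ^ 9 * d ^ 5) * s ≤ n with hQ
  have hsub : (univ.filter fun σ : Config n d m => ∃ S : Finset (Fin n),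
      16 * (3 ^ 9 * d ^ 5) * #S ≤ n ∧ 5 * #S < 4 * edgesInside σ S) ⊆
      Q.biUnion fun s => univ.filter fun σ : Config n d m =>
        ∃ S : Finset (Fin n), #S = s ∧ s + (s / 4 + 1) ≤ edgesInside σ S := by
    intro σ hσ
    obtain ⟨S, hS, h5⟩ := (mem_filter.1 hσ).2
    rw [mem_biUnion]
    refine ⟨#S, ?_, mem_filter.2 ⟨mem_univ _, S, rfl, by omega⟩⟩
    rw [hQ, mem_filter, mem_range]
    refine ⟨?_, ?_, hS⟩
    · have := card_le_univ S
      rw [Fintype.card_fin] at this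
      omega
    · rw [card_pos]
      by_contra hempty
      rw [not_nonempty_iff_eq_empty] at hempty
      subst hempty
      simp [edgesInside] at h5
  have hC : (0 : ℝ) ≤ 8 * (3 ^ 9 * d ^ 5) / n * Fintype.card (Config n d m) := by positivity
  calc _ ≤ (#(Q.biUnion fun s => univ.filter fun σ : Config n d m =>
        ∃ S : Finset (Fin n), #S = s ∧ s + (s / 4 + 1) ≤ edgesInside σ S) : ℝ) := by
        exact_mod_cast card_le_card hsub
    _ ≤ ∑ s ∈ Q, (#(univ.filter fun σ : Config n d m =>
        ∃ S : Finset (Fin n), #S = s ∧ s + (s / 4 + 1) ≤ edgesInside σ S) : ℝ) := by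
        exact_mod_cast card_biUnion_le
    _ ≤ ∑ s ∈ Q, (8 * (3 ^ 9 * (d : ℝ) ^ 5) / n * Fintype.card (Config n d m)) *
          ((s : ℝ) / 2 ^ s) := by
        refine sum_le_sum fun s hs => ?_
        rw [hQ, mem_filter] at hs
        refine (card_exists_edgesInside_le hN hd s _).trans ?_
        refine (mul_le_mul_of_nonneg_right (unionBound_term_le hN hd hs.2.1 hs.2.2)
          (Nat.cast_nonneg _)).trans_eq ?_
        ring
    _ ≤ ∑ s ∈ range (n + 1), (8 * (3 ^ 9 * (d : ℝ) ^ 5) / n * Fintype.card (Config n d m)) *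
          ((s : ℝ) / 2 ^ s) :=
        sum_le_sum_of_subset_of_nonneg (filter_subset _ _) fun s _ _ =>
          mul_nonneg hC (by positivity)
    _ ≤ (8 * (3 ^ 9 * d ^ 5) / n * Fintype.card (Config n d m)) * 2 := by
        rw [← mul_sum]
        exact mul_le_mul_of_nonneg_left (sum_range_div_two_pow_le _) hC
    _ = _ := by ring

end Sparsity

/-! ### Isolating sets and 3-colourings in sparse graphs -/

section SparseGraphs
open Finset

variable {V : Type*} [DecidableEq V]

open Classical in
/-- The number of ordered pairs of adjacent vertices in `S`. -/
def adjPairs (G : SimpleGraph V) (S : Finset V) : ℕ := ∑ v ∈ S, #{w ∈ S | G.Adj v w}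

open Classical in
theorem adjPairs_insert (G : SimpleGraph V) {S : Finset V} {x : V} (hx : x ∉ S) :
    adjPairs G (insert x S) = adjPairs G S + 2 * #{w ∈ S | G.Adj x w} := by
  have h1 : #{w ∈ insert x S | G.Adj x w} = #{w ∈ S | G.Adj x w} := by
    rw [filter_insert, if_neg (G.loopless.irrefl x)]
  have h2 : ∀ v, #{w ∈ insert x S | G.Adj v w} =
      #{w ∈ S | G.Adj v w} + if G.Adj x v then 1 else 0 := by
    intro v
    rw [filter_insert]
    by_cases h : G.Adj v x
    · rw [if_pos h, if_pos h.symm, card_insert_of_notMem (fun h' => hx (mem_filter.1 h').1)]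
    · rw [if_neg h, if_neg (fun h' => h h'.symm)]; rfl
  rw [adjPairs, sum_insert hx, h1, sum_congr rfl fun v _ => h2 v, sum_add_distrib, ← card_filter,
    adjPairs]
  ring

/-- Small vertex sets span few edges. -/
def IsSparse (G : SimpleGraph V) (L : ℕ) : Prop :=
  ∀ S : Finset V, #S ≤ L → 2 * adjPairs G S ≤ 5 * #S

/-- While U fails, adjoin both ends of an offending edge: two more vertices and at least six more
ordered adjacent pairs. After t steps sparsity forces 12t ≤ 5(|W| + 2t), which fails at t = 3|W| +
1, where |U| = 7|W| + 2. -/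
theorem IsSparse.exists_isolating {G : SimpleGraph V} {L : ℕ} (hG : IsSparse G L)
    (W : Finset V) (hW : 7 * #W + 2 ≤ L) :
    ∃ U : Finset V, W ⊆ U ∧ #U ≤ L ∧ ∀ x y, x ∉ U → y ∉ U → G.Adj x y →
      (∃ u ∈ U, G.Adj x u) → ¬ ∃ u ∈ U, G.Adj y u := by
  classical
  by_contra! hcon
  have key : ∀ t ≤ 3 * #W + 1, ∃ U : Finset V, W ⊆ U ∧ #U = #W + 2 * t ∧ 6 * t ≤ adjPairs G U := by
    intro t
    induction t with
    | zero => exact fun _ => ⟨W, Subset.rfl, by simp, by simp⟩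
    | succ t ih =>
      intro ht
      obtain ⟨U, hWU, hU, hUe⟩ := ih (by omega)
      obtain ⟨x, y, hx, hy, hxy, ⟨u, hu, hxu⟩, ⟨v, hv, hyv⟩⟩ := hcon U hWU (by omega)
      have hy' : y ∉ insert x U := by
        rw [mem_insert]; rintro (rfl | h)
        · exact G.loopless.irrefl _ hxy
        · exact hy h
      refine ⟨insert y (insert x U), ?_, ?_, ?_⟩
      · exact hWU.trans ((subset_insert _ _).trans (subset_insert _ _))
      · rw [card_insert_of_notMem hy', card_insert_of_notMem hx]; omega
      · rw [adjPairs_insert G hy', adjPairs_insert G hx]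
        have h1 : 0 < #{w ∈ U | G.Adj x w} := card_pos.2 ⟨u, mem_filter.2 ⟨hu, hxu⟩⟩
        have h2 : 1 < #{w ∈ insert x U | G.Adj y w} := by
          refine one_lt_card.2 ⟨x, mem_filter.2 ⟨mem_insert_self _ _, hxy.symm⟩, v,
            mem_filter.2 ⟨mem_insert_of_mem hv, hyv⟩, ?_⟩
          rintro rfl; exact hx hv
        omega
  obtain ⟨U, _, hU, hUe⟩ := key _ le_rfl
  have := hG U (by omega)
  omega

/-- Every small nonempty set has average degree at most 5/2, so some vertex has at most two
neighbours in it and can be coloured last. -/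
theorem IsSparse.exists_three_coloring {G : SimpleGraph V} {L : ℕ} (hG : IsSparse G L)
    (S : Finset V) (hS : #S ≤ L) :
    ∃ c : V → Fin 3, ∀ x ∈ S, ∀ y ∈ S, G.Adj x y → c x ≠ c y := by
  classical
  induction hk : #S generalizing S with
  | zero => exact ⟨fun _ => 0, by simp [card_eq_zero.1 hk]⟩
  | succ k ih =>
    have hdeg : ∃ v ∈ S, #{w ∈ S | G.Adj v w} ≤ 2 := by
      by_contra! hcon
      have h1 : #S * 3 ≤ adjPairs G S := by
        rw [← smul_eq_mul, adjPairs]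
        exact card_nsmul_le_sum S _ 3 hcon
      have := hG S hS
      omega
    obtain ⟨v, hv, hdv⟩ := hdeg
    obtain ⟨c, hc⟩ := ih (S.erase v) ((card_erase_le).trans hS) (by rw [card_erase_of_mem hv, hk]; rfl)
    obtain ⟨a, ha⟩ : ∃ a : Fin 3, a ∉ ({w ∈ S | G.Adj v w} : Finset V).image c := by
      by_contra! hcon
      have h1 : #(univ : Finset (Fin 3)) ≤ #(({w ∈ S | G.Adj v w} : Finset V).image c) :=
        card_le_card fun a _ => hcon a
      have h2 := card_image_le (s := ({w ∈ S | G.Adj v w} : Finset V)) (f := c)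
      simp only [card_univ, Fintype.card_fin] at h1
      omega
    have ha' : ∀ w ∈ S, G.Adj v w → c w ≠ a := fun w hw hvw e =>
      ha (mem_image.2 ⟨w, mem_filter.2 ⟨hw, hvw⟩, e⟩)
    refine ⟨Function.update c v a, fun x hx y hy hxy => ?_⟩
    by_cases h1 : x = v
    · subst h1
      have h2 : y ≠ x := hxy.ne'
      rw [Function.update_self, Function.update_of_ne h2]
      exact (ha' y hy hxy).symm
    · by_cases h2 : y = v
      · subst h2
        rw [Function.update_self, Function.update_of_ne h1]
        exact ha' x hx hxy.symm
      · rw [Function.update_of_ne h1, Function.update_of_ne h2]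
        exact hc x (mem_erase.2 ⟨h1, hx⟩) y (mem_erase.2 ⟨h2, hy⟩) hxy

end SparseGraphs

/-! ### Constructing orthogonal representations -/

section Theta
open Finset

/-- Orthogonal representation of `G` in an arbitrary inner product space `E`, together with a
handle `z` witnessing that `ϑ(Gᶜ) ≤ κ`. -/
def ThetaRep {V : Type*} (G : SimpleGraph V) (κ : ℝ) (E : Type*) [NormedAddCommGroup E]
    [InnerProductSpace ℝ E] : Prop :=
  ∃ (u : V → E) (z : E), (∀ i, ‖u i‖ = 1) ∧ (∀ i j, G.Adj i j → inner ℝ (u i) (u j) = 0) ∧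
    ‖z‖ = 1 ∧ ∀ i, inner ℝ (u i) z = 1 / √κ

theorem exists_linearIsometry_euclideanSpace (S : Type*) [NormedAddCommGroup S]
    [InnerProductSpace ℝ S] [FiniteDimensional ℝ S] {n : ℕ} (h : Module.finrank ℝ S ≤ n) :
    Nonempty (S →ₗᵢ[ℝ] EuclideanSpace ℝ (Fin n)) := by
  let b := stdOrthonormalBasis ℝ S
  let v : Fin (Module.finrank ℝ S) → EuclideanSpace ℝ (Fin n) :=
    fun i => EuclideanSpace.basisFun (Fin n) ℝ (Fin.castLE h i)
  have hv : Orthonormal ℝ v :=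
    (EuclideanSpace.basisFun (Fin n) ℝ).orthonormal.comp _ (Fin.castLE_injective h)
  refine ⟨LinearMap.isometryOfOrthonormal (b.toBasis.constr ℝ v) (v := b.toBasis) ?_ ?_⟩
  · simp [b.orthonormal]
  · have : (b.toBasis.constr ℝ v) ∘ b.toBasis = v := by
      ext1 i; simp only [Function.comp, Module.Basis.constr_basis]
    rw [this]; exact hv

/-- The span of the vectors embeds in ℝⁿ. Projecting the handle onto it preserves the inner
products, and renormalising the projection w gives the value κ‖w‖² ≤ κ. -/
theorem lovaszTheta_compl_le {n : ℕ} {G : SimpleGraph (Fin n)} {κ : ℝ} (hκ : 0 < κ)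
    {E : Type*} [NormedAddCommGroup E] [InnerProductSpace ℝ E] (h : ThetaRep G κ E) :
    lovaszTheta Gᶜ ≤ κ := by
  obtain ⟨u, z, hu, huo, hz, huz⟩ := h
  rcases Nat.eq_zero_or_pos n with rfl | hn
  -- ℝ⁰ has no unit vector, so the infimum is over the empty set and takes the default value 0.
  · have : {κ : ℝ | 0 < κ ∧ ∃ (u : Fin 0 → EuclideanSpace ℝ (Fin 0))
        (z : EuclideanSpace ℝ (Fin 0)), IsOrthogonalRepresentation Gᶜᶜ u ∧ ‖z‖ = 1 ∧
          ∀ i, inner ℝ (u i) z = 1 / √κ} = ∅ := by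
      rw [Set.eq_empty_iff_forall_notMem]
      rintro κ ⟨_, u, z, _, hz, _⟩
      rw [Subsingleton.elim z 0, norm_zero] at hz
      exact zero_ne_one hz
    rw [lovaszTheta, this, Real.sInf_empty]
    exact hκ.le
  let S : Submodule ℝ E := Submodule.span ℝ (Set.range u)
  have : FiniteDimensional ℝ S := FiniteDimensional.span_of_finite ℝ (Set.finite_range u)
  have hdim : Module.finrank ℝ S ≤ n :=
    (finrank_range_le_card (R := ℝ) u).trans_eq (Fintype.card_fin n)
  obtain ⟨T⟩ := exists_linearIsometry_euclideanSpace S hdim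
  let u' : Fin n → S := fun i => ⟨u i, Submodule.subset_span ⟨i, rfl⟩⟩
  let w : S := S.orthogonalProjectionOnto z
  have huw : ∀ i, inner ℝ (u' i) w = 1 / √κ := by
    intro i
    rw [← huz i, real_inner_comm, real_inner_comm z]
    exact Submodule.inner_orthogonalProjectionOnto_eq_of_mem_right (u' i) z
  have hsq : 0 < √κ := Real.sqrt_pos.2 hκ
  have hw0 : w ≠ 0 := by
    intro h0
    have := huw ⟨0, hn⟩
    rw [h0, inner_zero_right] at this
    have h1 : 0 < 1 / √κ := by positivity
    linarith
  have hr : 0 < ‖w‖ := norm_pos_iff.2 hw0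
  have hr1 : ‖w‖ ≤ 1 := hz ▸ S.norm_orthogonalProjectionOnto_apply_le z
  have hmem : κ * ‖w‖ ^ 2 ∈ {κ : ℝ | 0 < κ ∧ ∃ (u : Fin n → EuclideanSpace ℝ (Fin n))
        (z : EuclideanSpace ℝ (Fin n)), IsOrthogonalRepresentation Gᶜᶜ u ∧ ‖z‖ = 1 ∧
          ∀ i, inner ℝ (u i) z = 1 / √κ} := by
    refine ⟨by positivity, fun i => T (u' i), T ((‖w‖)⁻¹ • w), ⟨?_, ?_⟩, ?_, ?_⟩
    · intro i
      rw [T.norm_map]; exact hu i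
    · intro i j hij
      rw [compl_compl] at hij
      rw [T.inner_map_map]; exact huo i j hij
    · rw [T.norm_map, norm_smul, norm_inv, norm_norm, inv_mul_cancel₀ hr.ne']
    · intro i
      rw [T.inner_map_map, inner_smul_right, huw, Real.sqrt_mul hκ.le, Real.sqrt_sq hr.le]
      field_simp
  refine (csInf_le ⟨0, fun κ h => h.1.le⟩ hmem).trans ?_
  have : ‖w‖ ^ 2 ≤ 1 := pow_le_one₀ hr.le hr1
  nlinarith

/-- The strict inequality avoids proving that the infimum is attained. The standard basis with κ = n
shows that it is not over the empty set. -/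
theorem exists_thetaRep_of_lovaszTheta_lt {n : ℕ} (hn : 0 < n) {G : SimpleGraph (Fin n)} {θ : ℝ}
    (h : lovaszTheta Gᶜ < θ) :
    ∃ κ, 0 < κ ∧ κ < θ ∧ ThetaRep G κ (EuclideanSpace ℝ (Fin n)) := by
  have hne : {κ : ℝ | 0 < κ ∧ ∃ (u : Fin n → EuclideanSpace ℝ (Fin n))
        (z : EuclideanSpace ℝ (Fin n)), IsOrthogonalRepresentation Gᶜᶜ u ∧ ‖z‖ = 1 ∧
          ∀ i, inner ℝ (u i) z = 1 / √κ}.Nonempty := by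
    have hn' : (0 : ℝ) < n := by exact_mod_cast hn
    have hb := (EuclideanSpace.basisFun (Fin n) ℝ).orthonormal
    refine ⟨n, hn', EuclideanSpace.basisFun (Fin n) ℝ, WithLp.toLp 2 (fun _ => 1 / √n),
      ⟨hb.1, fun i j hij => hb.2 (by rintro rfl; exact (Gᶜᶜ).loopless.irrefl _ hij)⟩, ?_, ?_⟩
    · rw [EuclideanSpace.norm_eq]
      simp [hn'.ne']
    · intro i
      simp [EuclideanSpace.inner_single_left]
  obtain ⟨κ, ⟨h0, u, z, hu, hz, huz⟩, hlt⟩ := exists_lt_of_csInf_lt hne h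
  exact ⟨κ, h0, hlt, u, z, hu.unit, fun i j hij => hu.orthogonal i j (by rwa [compl_compl]),
    hz, huz⟩

theorem inner_toLp_prod {E F : Type*} [NormedAddCommGroup E] [InnerProductSpace ℝ E]
    [NormedAddCommGroup F] [InnerProductSpace ℝ F] (x x' : E) (y y' : F) :
    inner ℝ (WithLp.toLp 2 (x, y)) (WithLp.toLp 2 (x', y')) = inner ℝ x x' + inner ℝ y y' := by
  simp [WithLp.prod_inner_apply]

theorem norm_eq_one_of_inner_self {E : Type*} [NormedAddCommGroup E] [InnerProductSpace ℝ E]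
    {x : E} (h : inner ℝ x x = 1) : ‖x‖ = 1 := by
  rw [real_inner_self_eq_norm_sq] at h
  exact (pow_eq_one_iff_of_nonneg (norm_nonneg x) two_ne_zero).1 h

theorem inner_vec_five (x y : Fin 5 → ℝ) :
    inner ℝ (WithLp.toLp 2 x : EuclideanSpace ℝ (Fin 5)) (WithLp.toLp 2 y) =
      x 0 * y 0 + x 1 * y 1 + x 2 * y 2 + x 3 * y 3 + x 4 * y 4 := by
  simp [PiLp.inner_apply, Fin.sum_univ_five, mul_comm]

/-- Coordinates of the vector of a vertex in the coloured part. -/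
def colourVec (t r : ℝ) (c : Fin 3) : Fin 5 → ℝ :=
  ![(if c = 0 then 1 else 0) - t, (if c = 1 then 1 else 0) - t, (if c = 2 then 1 else 0) - t, r, 0]

/-- An orthogonal representation of the part `A`, a 3-colouring of the part `B` and one new
direction for the independent remainder give a representation of the whole graph. -/
theorem thetaRep_add_one {V : Type*} {G : SimpleGraph V} {κ l : ℝ} (hκ : 0 < κ) (hκl : κ ≤ l)
    (hl : 3 ≤ l) {E : Type*} [NormedAddCommGroup E] [InnerProductSpace ℝ E] {A B : V → Prop}
    {u : V → E} {z : E} (hu : ∀ i, A i → ‖u i‖ = 1)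
    (huo : ∀ i j, A i → A j → G.Adj i j → inner ℝ (u i) (u j) = 0) (hz : ‖z‖ = 1)
    (huz : ∀ i, A i → inner ℝ (u i) z = 1 / √κ) (hAB : ∀ i j, A i → B j → ¬ G.Adj i j)
    (hI : ∀ i j, ¬ A i → ¬ B i → ¬ A j → ¬ B j → ¬ G.Adj i j)
    {c : V → Fin 3} (hc : ∀ i j, B i → B j → G.Adj i j → c i ≠ c j) :
    ThetaRep G (l + 1) (WithLp 2 (E × EuclideanSpace ℝ (Fin 5))) := by
  classical
  have hl0 : 0 < l := by linarith
  have hsκ : 0 < √κ := Real.sqrt_pos.2 hκ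
  have hsl : 0 < √l := Real.sqrt_pos.2 hl0
  have hsl1 : 0 < √(l + 1) := Real.sqrt_pos.2 (by linarith)
  have hsκ2 : √κ ^ 2 = κ := Real.sq_sqrt hκ.le
  have hsl2 : √l ^ 2 = l := Real.sq_sqrt hl0.le
  have hsl12 : √(l + 1) ^ 2 = l + 1 := Real.sq_sqrt (by linarith)
  -- The padded handle h = (a z, b e₃) has inner product q with the vectors of A. The final handle
  -- a'h + p e₄ then has inner product a'q = p with them, and p with the new direction e₄. Coloured
  -- vectors are q h plus a vector orthogonal to h and e₄, so they also give a'q = p.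
  obtain ⟨q, hq⟩ : ∃ q, q = 1 / √l := ⟨_, rfl⟩
  obtain ⟨p, hp⟩ : ∃ p, p = 1 / √(l + 1) := ⟨_, rfl⟩
  obtain ⟨a, ha⟩ : ∃ a, a = √κ / √l := ⟨_, rfl⟩
  obtain ⟨a', ha'⟩ : ∃ a', a' = √l / √(l + 1) := ⟨_, rfl⟩
  obtain ⟨b, hab⟩ : ∃ b : ℝ, a ^ 2 + b ^ 2 = 1 := by
    refine ⟨√(1 - a ^ 2), ?_⟩
    rw [Real.sq_sqrt]; · ring
    rw [ha, div_pow, hsκ2, hsl2, sub_nonneg, div_le_one hl0]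
    exact hκl
  have hq2 : q ^ 2 = 1 / l := by rw [hq, div_pow, hsl2, one_pow]
  -- The vectors e_c − t(e₀ + e₁ + e₂) must have Gram matrix δ − q² to cancel the q² from the common
  -- part q h. A real t exists exactly when q² = 1/l ≤ 1/3.
  obtain ⟨t, ht⟩ : ∃ t : ℝ, 3 * t ^ 2 - 2 * t = - q ^ 2 := by
    refine ⟨(1 - √(1 - 3 / l)) / 3, ?_⟩
    have h3 : √(1 - 3 / l) ^ 2 = 1 - 3 / l := by
      apply Real.sq_sqrt
      rw [sub_nonneg, div_le_one hl0]; exact hl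
    have e3 : (3 : ℝ) / l = 3 * (1 / l) := by ring
    rw [hq2]
    rw [e3] at h3 ⊢
    nlinarith
  have haq : a * (1 / √κ) = q := by rw [ha, hq]; field_simp
  have ha'q : a' * q = p := by rw [ha', hq, hp]; field_simp
  have hap : a' ^ 2 + p ^ 2 = 1 := by
    rw [ha', hp, div_pow, div_pow, hsl2, hsl12, ← add_div, one_pow, div_self]
    linarith
  have hz' : inner ℝ z z = 1 := by rw [real_inner_self_eq_norm_sq, hz, one_pow]
  have hu' : ∀ i, A i → inner ℝ (u i) (u i) = 1 := fun i hi => by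
    rw [real_inner_self_eq_norm_sq, hu i hi, one_pow]
  have hcc : ∀ c : Fin 3, inner ℝ (WithLp.toLp 2 ((q * a) • z, WithLp.toLp 2 (colourVec t (q * b) c)) :
      WithLp 2 (E × EuclideanSpace ℝ (Fin 5)))
      (WithLp.toLp 2 ((q * a) • z, WithLp.toLp 2 (colourVec t (q * b) c))) = 1 := by
    intro c
    rw [inner_toLp_prod, inner_vec_five, real_inner_smul_left, real_inner_smul_right, hz']
    fin_cases c <;> simp [colourVec] <;> linear_combination ht + q ^ 2 * hab
  have hcd : ∀ c d : Fin 3, c ≠ d →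
      inner ℝ (WithLp.toLp 2 ((q * a) • z, WithLp.toLp 2 (colourVec t (q * b) c)) :
      WithLp 2 (E × EuclideanSpace ℝ (Fin 5)))
      (WithLp.toLp 2 ((q * a) • z, WithLp.toLp 2 (colourVec t (q * b) d))) = 0 := by
    intro c d hcd
    rw [inner_toLp_prod, inner_vec_five, real_inner_smul_left, real_inner_smul_right, hz']
    fin_cases c <;> fin_cases d <;> simp [colourVec] at hcd ⊢ <;>
      linear_combination ht + q ^ 2 * hab
  refine ⟨fun i => if A i then WithLp.toLp 2 (u i, WithLp.toLp 2 0)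
    else if B i then WithLp.toLp 2 ((q * a) • z, WithLp.toLp 2 (colourVec t (q * b) (c i)))
    else WithLp.toLp 2 (0, WithLp.toLp 2 ![0, 0, 0, 0, 1]),
    WithLp.toLp 2 ((a' * a) • z, WithLp.toLp 2 ![0, 0, 0, a' * b, p]), ?_, ?_, ?_, ?_⟩
  · intro i
    apply norm_eq_one_of_inner_self
    by_cases hA : A i
    · simp only [hA, if_true]
      rw [inner_toLp_prod, inner_vec_five, hu' i hA]; simp
    by_cases hB : B i
    · simp only [hA, hB, if_true, if_false]
      exact hcc _
    · simp only [hA, hB, if_false]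
      rw [inner_toLp_prod, inner_vec_five]; simp
  · intro i j hij
    by_cases hAi : A i <;> by_cases hAj : A j <;> by_cases hBi : B i <;> by_cases hBj : B j <;>
      simp only [hAi, hAj, hBi, hBj, if_true, if_false]
    all_goals first
      | exact absurd hij (hAB i j hAi hBj)
      | exact absurd hij.symm (hAB j i hAj hBi)
      | exact absurd hij (hI i j hAi hBi hAj hBj)
      | exact hcd _ _ (hc i j hBi hBj hij)
      | (rw [inner_toLp_prod, inner_vec_five]; simp [colourVec, huo, hAi, hAj, hij])
  · apply norm_eq_one_of_inner_self
    rw [inner_toLp_prod, inner_vec_five, real_inner_smul_left, real_inner_smul_right, hz']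
    simp
    linear_combination a' ^ 2 * hab + hap
  · intro i
    rw [← hp]
    by_cases hA : A i
    · simp only [hA, if_true]
      rw [inner_toLp_prod, inner_vec_five, real_inner_smul_right, huz i hA, mul_assoc, haq, ha'q]
      simp
    by_cases hB : B i
    · simp only [hA, hB, if_true, if_false]
      rw [inner_toLp_prod, inner_vec_five, real_inner_smul_left, real_inner_smul_right, hz']
      simp [colourVec]
      linear_combination a' * q * hab + ha'q
    · simp only [hA, hB, if_false]
      rw [inner_toLp_prod, inner_vec_five]; simp

end Theta

/-! ### Regular graphs as conditioned configurations -/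

section Fibres
open Finset Equiv

theorem cycleType_of_involution {α : Type*} [Fintype α] [DecidableEq α] (f : Perm α)
    (h2 : f ^ 2 = 1) (hf : ∀ a, f a ≠ a) :
    f.cycleType = Multiset.replicate (Fintype.card α / 2) 2 := by
  have h := Perm.cycleType_of_pow_prime_eq_one (p := 2) h2
  have hs : f.cycleType.sum = Fintype.card α := by
    rw [Perm.sum_cycleType, ← card_univ]
    congr 1
    ext a; simpa using hf a
  have hk : 2 * Multiset.card f.cycleType = Fintype.card α := by
    rw [← hs]
    conv_rhs => rw [h]
    simp [mul_comm]
  rw [h]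
  congr 1
  omega

/-- Fixed-point-free involutions on sets of equal size have the same cycle type, hence are
conjugate. -/
theorem exists_equivariant_equiv {α β : Type*} [Fintype α] [Fintype β] (e : α ≃ β)
    {f : α → α} {g : β → β} (hf : Function.Involutive f) (hg : Function.Involutive g)
    (hfa : ∀ a, f a ≠ a) (hgb : ∀ b, g b ≠ b) :
    ∃ c : α ≃ β, ∀ a, c (f a) = g (c a) := by
  classical
  let s : Perm α := hf.toPerm
  let s' : Perm α := (e.trans hg.toPerm).trans e.symm
  have h1 : s.cycleType = Multiset.replicate (Fintype.card α / 2) 2 :=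
    cycleType_of_involution s (by ext a; simp [s, sq, hf a]) (fun a => hfa a)
  have h2 : s'.cycleType = Multiset.replicate (Fintype.card α / 2) 2 := by
    refine cycleType_of_involution s' (by ext a; simp [s', sq, hg (e a)]) (fun a h => ?_)
    refine hgb (e a) ?_
    simpa [s', symm_apply_eq] using h
  obtain ⟨c, hc⟩ := isConj_iff.1 (Perm.isConj_iff_cycleType_eq.2 (h1.trans h2.symm))
  refine ⟨c.trans e, fun a => ?_⟩
  have h3 : c * s = s' * c := by rw [← hc]; simp
  have h4 := congrArg (fun π : Perm α => e (π a)) h3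
  simpa [s, s'] using h4

variable {n d m : ℕ}

/-- The graph underlying a configuration. -/
def toGraph (σ : Config n d m) : SimpleGraph (Fin n) where
  Adj v w := v ≠ w ∧ ∃ x, dartOf (ends σ) x = (v, w)
  symm := ⟨by
    rintro v w ⟨hne, x, hx⟩
    refine ⟨hne.symm, opp x, ?_⟩
    simp only [dartOf, Prod.mk.injEq, opp_opp] at hx ⊢
    exact ⟨hx.2, hx.1⟩⟩
  loopless := ⟨fun _ h => h.1 rfl⟩

theorem IsSimple.ends_opp_ne {σ : Config n d m} (h : IsSimple σ) (x : Fin m × Bool) :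
    ends σ x ≠ ends σ (opp x) := fun e =>
  opp_ne x (h (by simp [dartOf, e]))

theorem IsSimple.toGraph_adj {σ : Config n d m} (h : IsSimple σ) {v w : Fin n} :
    (toGraph σ).Adj v w ↔ ∃ x, dartOf (ends σ) x = (v, w) := by
  refine ⟨fun h => h.2, fun ⟨x, hx⟩ => ⟨?_, x, hx⟩⟩
  simp only [dartOf, Prod.mk.injEq] at hx
  rw [← hx.1, ← hx.2]
  exact h.ends_opp_ne x

theorem mem_regularGraphs {G : SimpleGraph (Fin n)} :
    G ∈ regularGraphs n d ↔ ∀ v, Nat.card (G.neighborSet v) = d := by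
  classical
  simp only [regularGraphs, mem_filter, mem_univ, true_and, SimpleGraph.IsRegularOfDegree,
    ← SimpleGraph.card_neighborSet_eq_degree, Nat.card_eq_fintype_card]

theorem IsSimple.toGraph_mem {σ : Config n d m} (h : IsSimple σ) :
    toGraph σ ∈ regularGraphs n d := by
  classical
  rw [mem_regularGraphs]
  intro v
  have e : {x // ends σ x = v} ≃ (toGraph σ).neighborSet v := by
    refine Equiv.ofBijective (fun x => ⟨ends σ (opp x), ?_⟩) ⟨?_, ?_⟩
    · exact h.toGraph_adj.2 ⟨x.1, by simp [dartOf, x.2]⟩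
    · rintro ⟨x, hx⟩ ⟨y, hy⟩ hxy
      replace hxy : ends σ (opp x) = ends σ (opp y) := congrArg Subtype.val hxy
      rw [Subtype.mk.injEq]
      exact h (by simp [dartOf, hx, hy, hxy])
    · rintro ⟨w, hw⟩
      obtain ⟨x, hx⟩ := h.toGraph_adj.1 hw
      simp only [dartOf, Prod.mk.injEq] at hx
      exact ⟨⟨x, hx.1⟩, Subtype.ext hx.2⟩
  rw [← Nat.card_congr e, Nat.card_eq_fintype_card, Fintype.card_subtype]
  exact card_ends_eq σ v

/-- A simple configuration with graph `G` amounts to a labelling of the darts of `G` by edge ends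
and one by half-edges at the vertices. -/
def fibreEquiv (G : SimpleGraph (Fin n)) :
    {σ : Config n d m // IsSimple σ ∧ toGraph σ = G} ≃
      {ψ : (Fin m × Bool) ≃ G.Dart // ∀ x, ψ (opp x) = (ψ x).symm} ×
      {L : G.Dart ≃ (Fin n × Fin d) // ∀ a, (L a).1 = a.fst} where
  toFun σ :=
    have hadj : ∀ x, G.Adj (ends σ.1 x) (ends σ.1 (opp x)) := fun x =>
      σ.2.2.le (σ.2.1.toGraph_adj.2 ⟨x, rfl⟩)
    let ψ : (Fin m × Bool) ≃ G.Dart := Equiv.ofBijective (fun x => ⟨dartOf (ends σ.1) x, hadj x⟩) ⟨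
      fun x y hxy => σ.2.1 (congrArg SimpleGraph.Dart.toProd hxy), fun a => by
        obtain ⟨x, hx⟩ := σ.2.1.toGraph_adj.1 (σ.2.2.ge a.adj)
        exact ⟨x, SimpleGraph.Dart.ext _ _ hx⟩⟩
    (⟨ψ, fun x => SimpleGraph.Dart.ext _ _ (by simp [ψ, dartOf])⟩,
      ⟨ψ.symm.trans σ.1, fun a => by
        obtain ⟨x, rfl⟩ := ψ.surjective a
        simp only [trans_apply, symm_apply_apply]
        rfl⟩)
  invFun p :=
    have hend : ∀ x, ends (p.1.1.trans p.2.1) x = (p.1.1 x).fst := fun x => p.2.2 (p.1.1 x)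
    have hdart : ∀ x, dartOf (ends (p.1.1.trans p.2.1)) x = (p.1.1 x).toProd := fun x => by
      rw [dartOf, hend, hend, p.1.2]; rfl
    have hs : IsSimple (p.1.1.trans p.2.1) := fun x y hxy => by
      rw [hdart, hdart] at hxy
      exact p.1.1.injective (SimpleGraph.Dart.ext _ _ hxy)
    ⟨p.1.1.trans p.2.1, hs, by
      ext v w
      rw [hs.toGraph_adj]
      simp only [hdart]
      constructor
      · rintro ⟨x, hx⟩
        have := (p.1.1 x).adj
        rwa [hx] at this
      · intro h
        obtain ⟨x, hx⟩ := p.1.1.surjective ⟨(v, w), h⟩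
        exact ⟨x, by rw [hx]⟩⟩
  left_inv σ := by
    apply Subtype.ext
    ext1 x
    simp
  right_inv p := by
    have h : ∀ x h', (⟨dartOf (ends (p.1.1.trans p.2.1)) x, h'⟩ : G.Dart) = p.1.1 x := by
      intro x h'
      refine SimpleGraph.Dart.ext _ _ ?_
      have hend : ∀ x, ends (p.1.1.trans p.2.1) x = (p.1.1 x).fst := fun x => p.2.2 (p.1.1 x)
      change dartOf (ends (p.1.1.trans p.2.1)) x = _
      rw [dartOf, hend, hend, p.1.2]; rfl
    refine Prod.ext (Subtype.ext (Equiv.ext fun x => h x _)) (Subtype.ext (Equiv.ext fun a => ?_))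
    obtain ⟨x, rfl⟩ := p.1.1.surjective a
    simp only [trans_apply]
    congr 1
    congr 1
    rw [symm_apply_eq]
    exact (h x _).symm

/-- The two factors of `fibreEquiv` are transported independently: half-edge labels along a dart
bijection preserving initial vertices, edge labels along one commuting with reversal. One bijection
need not do both. -/
theorem card_fibre_eq {G G' : SimpleGraph (Fin n)} (hG : G ∈ regularGraphs n d)
    (hG' : G' ∈ regularGraphs n d) :
    Nat.card {σ : Config n d m // IsSimple σ ∧ toGraph σ = G} =
      Nat.card {σ : Config n d m // IsSimple σ ∧ toGraph σ = G'} := by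
  classical
  rw [mem_regularGraphs] at hG hG'
  have hcard : ∀ (H : SimpleGraph (Fin n)), (∀ v, Nat.card (H.neighborSet v) = d) →
      ∀ v, Fintype.card {a : H.Dart // a.fst = v} = d := by
    intro H hH v
    rw [Fintype.card_subtype, SimpleGraph.dart_fst_fiber_card_eq_degree,
      ← SimpleGraph.card_neighborSet_eq_degree, ← Nat.card_eq_fintype_card, hH]
  let e : G.Dart ≃ G'.Dart :=
    (Equiv.sigmaFiberEquiv (fun a : G.Dart => a.fst)).symm.trans
      ((Equiv.sigmaCongrRight fun v =>
        Fintype.equivOfCardEq ((hcard G hG v).trans (hcard G' hG' v).symm)).trans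
        (Equiv.sigmaFiberEquiv (fun a : G'.Dart => a.fst)))
  have he : ∀ a, (e a).fst = a.fst := by
    intro a
    exact (Fintype.equivOfCardEq ((hcard G hG a.fst).trans (hcard G' hG' a.fst).symm)
      ⟨a, rfl⟩).2
  obtain ⟨c, hc⟩ := exists_equivariant_equiv e (SimpleGraph.Dart.symm_involutive (G := G))
    (SimpleGraph.Dart.symm_involutive (G := G')) SimpleGraph.Dart.symm_ne
    SimpleGraph.Dart.symm_ne
  have e1 : {ψ : (Fin m × Bool) ≃ G.Dart // ∀ x, ψ (opp x) = (ψ x).symm} ≃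
      {ψ : (Fin m × Bool) ≃ G'.Dart // ∀ x, ψ (opp x) = (ψ x).symm} := by
    refine Equiv.subtypeEquiv (Equiv.equivCongr (Equiv.refl _) c) fun ψ => ?_
    simp only [equivCongr_apply_apply, refl_symm, refl_apply, ← hc, c.apply_eq_iff_eq]
  have e2 : {L : G.Dart ≃ (Fin n × Fin d) // ∀ a, (L a).1 = a.fst} ≃
      {L : G'.Dart ≃ (Fin n × Fin d) // ∀ a, (L a).1 = a.fst} := by
    refine Equiv.subtypeEquiv (Equiv.equivCongr e (Equiv.refl _)) fun L => ?_
    simp only [equivCongr_apply_apply, refl_apply]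
    constructor
    · intro h a
      rw [h, ← he, apply_symm_apply]
    · intro h a
      have := h (e a)
      rwa [symm_apply_apply, he] at this
  exact Nat.card_congr ((fibreEquiv G).trans ((Equiv.prodCongr e1 e2).trans (fibreEquiv G').symm))

open Classical in
/-- Probabilities in `G_{n,d}` are conditional probabilities in the configuration model. -/
theorem probability_eq (E : SimpleGraph (Fin n) → Prop)
    (hne : ∃ σ : Config n d m, IsSimple σ) :
    probability n d E = (#{σ : Config n d m | IsSimple σ ∧ E (toGraph σ)} : ℝ) /
      #{σ : Config n d m | IsSimple σ} := by
  obtain ⟨σ₀, h₀⟩ := hne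
  set F := Nat.card {σ : Config n d m // IsSimple σ ∧ toGraph σ = toGraph σ₀} with hF
  have hfib : ∀ G ∈ regularGraphs n d, #{σ : Config n d m | IsSimple σ ∧ toGraph σ = G} = F := by
    intro G hG
    rw [hF, ← card_fibre_eq hG h₀.toGraph_mem, Nat.card_eq_fintype_card, Fintype.card_subtype]
  have hFpos : 0 < F := by
    rw [← hfib _ h₀.toGraph_mem]
    exact card_pos.2 ⟨σ₀, by simp [h₀]⟩
  have hcount : ∀ E : SimpleGraph (Fin n) → Prop,
      #{σ : Config n d m | IsSimple σ ∧ E (toGraph σ)} = #((regularGraphs n d).filter E) * F := by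
    intro E
    rw [card_eq_sum_card_fiberwise (f := toGraph) (t := (regularGraphs n d).filter E),
      ← smul_eq_mul, ← sum_const]
    · refine sum_congr rfl fun G hG => ?_
      rw [mem_filter] at hG
      rw [← hfib G hG.1, filter_filter]
      congr 1
      ext σ
      simp only [mem_filter, mem_univ, true_and]
      constructor
      · rintro ⟨⟨h1, _⟩, h2⟩; exact ⟨h1, h2⟩
      · rintro ⟨h1, h2⟩; exact ⟨⟨h1, h2 ▸ hG.2⟩, h2⟩
    · intro σ hσ
      have := (mem_filter.1 (mem_coe.1 hσ)).2
      exact mem_coe.2 (mem_filter.2 ⟨this.1.toGraph_mem, this.2⟩)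
  have h1 := hcount E
  have h2 := hcount fun _ => True
  simp only [and_true, filter_true] at h2
  rw [probability, h1, h2]
  push_cast
  rw [mul_div_mul_right _ _ (by exact_mod_cast hFpos.ne')]

end Fibres

/-! ### From a nearby configuration to the bound θ + 1 -/

section Deterministic
open Finset

theorem lovaszTheta_compl_le_add_one {n : ℕ} (hn : 0 < n) {G G' : SimpleGraph (Fin n)} {L : ℕ}
    {θ : ℝ} (hθ : 3 ≤ θ) (hG : IsSparse G L) (W : Finset (Fin n)) (hW : 7 * #W + 2 ≤ L)
    (hsub : ∀ i j, i ∉ W → j ∉ W → G.Adj i j → G'.Adj i j) (hG' : lovaszTheta G'ᶜ ≤ θ) :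
    lovaszTheta Gᶜ ≤ θ + 1 := by
  refine le_of_forall_pos_le_add fun ε hε => ?_
  obtain ⟨κ, hκ, hκθ, u, z, hu, huo, hz, huz⟩ :=
    exists_thetaRep_of_lovaszTheta_lt hn (hG'.trans_lt (lt_add_of_pos_right θ hε))
  obtain ⟨U, hWU, hUL, hU⟩ := hG.exists_isolating W hW
  obtain ⟨c, hc⟩ := hG.exists_three_coloring U hUL
  have := thetaRep_add_one (G := G) (A := fun i => i ∉ U ∧ ¬ ∃ v ∈ U, G.Adj i v)
    (B := fun i => i ∈ U) hκ hκθ.le (by linarith) (fun i _ => hu i)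
    -- Off W every edge of `G` is an edge of `G'`, so the vectors representing `G'` remain valid
    -- there.
    (fun i j hi hj hij => huo i j (hsub i j (fun h => hi.1 (hWU h)) (fun h => hj.1 (hWU h)) hij))
    hz (fun i _ => huz i) (fun i j hi hj hij => hi.2 ⟨j, hj, hij⟩)
    (fun i j hi hi' hj hj' hij => hU i j hi' hj' hij (not_not.1 fun h => hi ⟨hi', h⟩)
      (not_not.1 fun h => hj ⟨hj', h⟩))
    (c := c) (fun i j hi hj hij => hc i hi j hj hij)
  have h := lovaszTheta_compl_le (by linarith) this
  linarith

theorem lovaszTheta_compl_le_of_no_edges {n : ℕ} {G : SimpleGraph (Fin n)} {θ : ℝ} (hθ : 3 ≤ θ)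
    (hG : ∀ i j, ¬ G.Adj i j) : lovaszTheta Gᶜ ≤ θ + 1 := by
  have := thetaRep_add_one (G := G) (A := fun _ => False) (B := fun _ => True) (E := ℝ)
    (u := fun _ => 0) (z := 1) (c := fun _ => 0) (κ := θ) (l := θ) (by linarith) le_rfl hθ
    (fun _ h => h.elim) (fun _ _ h => h.elim) (by simp) (fun _ h => h.elim) (fun _ _ h => h.elim)
    (fun _ _ _ h => absurd trivial h) (fun i j _ _ h => absurd h (hG i j))
  exact lovaszTheta_compl_le (by linarith) this

variable {n d m : ℕ}

theorem adjPairs_toGraph_le (σ : Config n d m) (S : Finset (Fin n)) :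
    adjPairs (toGraph σ) S ≤ 2 * edgesInside σ S := by
  classical
  have h1 : adjPairs (toGraph σ) S = #{p ∈ S ×ˢ S | (toGraph σ).Adj p.1 p.2} := by
    rw [adjPairs, card_filter, sum_product]
    refine sum_congr rfl fun v _ => ?_
    rw [card_filter]
  have h2 : ({p ∈ S ×ˢ S | (toGraph σ).Adj p.1 p.2} : Finset _) ⊆
      ((univ.filter fun i : Fin m => ends σ (i, false) ∈ S ∧ ends σ (i, true) ∈ S) ×ˢ
        (univ : Finset Bool)).image (dartOf (ends σ)) := by
    rintro ⟨v, w⟩ h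
    obtain ⟨hS, hne, ⟨i, b⟩, hx⟩ := mem_filter.1 h
    rw [mem_product] at hS
    refine mem_image.2 ⟨(i, b), mem_product.2 ⟨mem_filter.2 ⟨mem_univ _, ?_⟩, mem_univ _⟩, hx⟩
    simp only [dartOf, Prod.mk.injEq] at hx
    rw [← hx.1, ← hx.2] at hS
    cases b
    · exact hS
    · exact hS.symm
  rw [h1]
  refine (card_le_card h2).trans (card_image_le.trans_eq ?_)
  rw [card_product, card_univ, Fintype.card_bool, edgesInside, mul_comm]

/-- The distance from `σ` to a nonempty set of configurations. -/
def distTo (A : Finset (Config n d m)) (hA : A.Nonempty) (σ : Config n d m) : ℕ :=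
  A.inf' hA fun τ => #{x | σ x ≠ τ x}

theorem distTo_swap_le (A : Finset (Config n d m)) (hA : A.Nonempty) (σ : Config n d m)
    (a b : Fin m × Bool) :
    distTo A hA ((Equiv.swap a b).trans σ) ≤ distTo A hA σ + 2 := by
  obtain ⟨τ, hτ, h⟩ := exists_mem_eq_inf' hA fun τ => #{x | σ x ≠ τ x}
  rw [distTo, distTo, h]
  refine (inf'_le _ hτ).trans ?_
  have : (univ.filter fun x => ((Equiv.swap a b).trans σ) x ≠ τ x) ⊆
      (univ.filter fun x => σ x ≠ τ x) ∪ {a, b} := by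
    intro x hx
    simp only [mem_filter, mem_univ, true_and, mem_union, mem_insert, mem_singleton] at hx ⊢
    by_contra! hcon
    rw [Equiv.trans_apply, Equiv.swap_apply_of_ne_of_ne hcon.2.1 hcon.2.2] at hx
    exact hx hcon.1
  exact (card_le_card this).trans ((card_union_le _ _).trans (Nat.add_le_add_left card_le_two _))

theorem abs_distTo_swap_le (A : Finset (Config n d m)) (hA : A.Nonempty) (σ : Config n d m)
    (a b : Fin m × Bool) :
    |(distTo A hA ((Equiv.swap a b).trans σ) : ℝ) - distTo A hA σ| ≤ 2 := by
  have h1 := distTo_swap_le A hA σ a b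
  have h2 := distTo_swap_le A hA ((Equiv.swap a b).trans σ) a b
  have h3 : (Equiv.swap a b).trans ((Equiv.swap a b).trans σ) = σ := by ext1 x; simp
  rw [h3] at h2
  have h1' : (distTo A hA ((Equiv.swap a b).trans σ) : ℝ) ≤ distTo A hA σ + 2 := by
    exact_mod_cast h1
  have h2' : (distTo A hA σ : ℝ) ≤ distTo A hA ((Equiv.swap a b).trans σ) + 2 := by
    exact_mod_cast h2
  rw [abs_le]
  constructor <;> linarith

/-- Let W contain both ends, in σ, of each edge with a half-edge where σ and τ disagree. Then |W| is
at most twice the distance, and 7|W| accounts for the 14. -/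
theorem lovaszTheta_toGraph_le {θ : ℝ} (hθ : 3 ≤ θ) (hn : 0 < n) {σ τ : Config n d m} {L : ℕ}
    (hL : ∀ S : Finset (Fin n), #S ≤ L → 4 * edgesInside σ S ≤ 5 * #S)
    (hτ : lovaszTheta (toGraph τ)ᶜ ≤ θ) (hστ : 14 * #{x | σ x ≠ τ x} + 2 ≤ L) :
    lovaszTheta (toGraph σ)ᶜ ≤ θ + 1 := by
  classical
  set D : Finset (Fin m × Bool) := {x | σ x ≠ τ x} with hD
  have hσD : ∀ x, x ∉ D → ends σ x = ends τ x := by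
    intro x hx
    have : σ x = τ x := by
      by_contra h
      exact hx (mem_filter.2 ⟨mem_univ _, h⟩)
    rw [ends, ends, this]
  set W : Finset (Fin n) := D.image (ends σ) ∪ D.image fun x => ends σ (opp x) with hWd
  have hW : #W ≤ 2 * #D := by
    refine (card_union_le _ _).trans ?_
    have h1 := card_image_le (s := D) (f := ends σ)
    have h2 := card_image_le (s := D) (f := fun x => ends σ (opp x))
    omega
  refine lovaszTheta_compl_le_add_one hn (L := L) hθ ?_ W (by omega) ?_ hτ
  · intro S hS
    have h1 := adjPairs_toGraph_le σ S
    have h2 := hL S hS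
    omega
  · rintro i j hi hj ⟨hne, x, hx⟩
    refine ⟨hne, x, ?_⟩
    simp only [dartOf, Prod.mk.injEq] at hx ⊢
    have h1 : x ∉ D := fun h => hi (mem_union_left _ (mem_image.2 ⟨x, h, hx.1⟩))
    have h2 : opp x ∉ D := fun h =>
      hi (mem_union_right _ (mem_image.2 ⟨opp x, h, by rw [opp_opp]; exact hx.1⟩))
    rw [← hσD x h1, ← hσD _ h2]
    exact hx

end Deterministic

/-! ### Assembling the probability estimates -/

section Main
open Finset

variable {n d m : ℕ}

open Classical in
/-- If the simple configurations with `ϑ ≤ θ` have density at least `c`, then configurations with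
`ϑ > θ + 1` have density `O(1 / n)`. -/
theorem card_theta_gt_le (hN : n * d = 2 * m) (hd : 0 < d) {θ c : ℝ} (hθ : 3 ≤ θ) (hc : 0 < c)
    (hA : c * Fintype.card (Config n d m) ≤
      #{σ : Config n d m | IsSimple σ ∧ lovaszTheta (toGraph σ)ᶜ ≤ θ})
    (hΩ : 0 < Fintype.card (Config n d m)) (hn64 : 64 * (3 ^ 9 * d ^ 5) ≤ n)
    (hnc : 64 * d * (512 * (3 ^ 9 * d ^ 5)) ^ 2 ≤ c * n) :
    (#{σ : Config n d m | ¬ lovaszTheta (toGraph σ)ᶜ ≤ θ + 1} : ℝ) ≤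
      (64 * d * (512 * (3 ^ 9 * d ^ 5)) ^ 2 + 16 * (3 ^ 9 * d ^ 5)) / n *
        Fintype.card (Config n d m) := by
  set A : Finset (Config n d m) := {σ | IsSimple σ ∧ lovaszTheta (toGraph σ)ᶜ ≤ θ} with hAd
  have hΩ' : (0 : ℝ) < Fintype.card (Config n d m) := by exact_mod_cast hΩ
  have hAne : A.Nonempty := by
    rw [← card_pos]
    have : (0 : ℝ) < #A := lt_of_lt_of_le (by positivity) hA
    exact_mod_cast this
  set C : ℕ := 3 ^ 9 * d ^ 5 with hC
  have hC0 : 0 < C := by positivity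
  have hC0' : (0 : ℝ) < C := by exact_mod_cast hC0
  have hCr : (3 : ℝ) ^ 9 * d ^ 5 = C := by rw [hC]; push_cast; ring
  rw [hCr] at hnc ⊢
  have hn : 0 < n := by omega
  have hn' : (0 : ℝ) < n := by exact_mod_cast hn
  -- Distance below t gives 14 · distance + 2 ≤ n/(16C): after multiplying by 16C, the first term is
  -- below 224n/512 and the second, 32C, is at most n/2 by `hn64`.
  set t : ℝ := n / (512 * C) with ht
  have ht0 : 0 < t := by positivity
  have hcardα : (Fintype.card (Fin m × Bool) : ℝ) = n * d := by
    rw [Fintype.card_prod, Fintype.card_fin, Fintype.card_bool, mul_comm m 2, ← hN]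
    push_cast; ring
  have hdist := card_le_of_lipschitz (L := 2) (c := c) (t := t)
    (fun σ : Config n d m => (distTo A hAne σ : ℝ)) (fun σ a b => abs_distTo_swap_le A hAne σ a b)
    hc ht0 (by
      refine hA.trans ?_
      norm_cast
      refine card_le_card fun σ hσ => ?_
      rw [mem_filter]
      refine ⟨mem_univ _, ?_⟩
      rw [← Nat.le_zero]
      refine (inf'_le _ hσ).trans ?_
      simp) (by
      rw [hcardα, ht, div_pow, ← mul_div_assoc, le_div_iff₀ (by positivity)]
      calc 16 * (2 : ℝ) ^ 2 * (n * d) * (512 * C) ^ 2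
          = (64 * d * (512 * C) ^ 2) * n := by ring
        _ ≤ (c * n) * n := by gcongr
        _ = _ := by ring)
  have hsparse := card_not_sparse_le (n := n) (d := d) (m := m) hN hd
  rw [hCr] at hsparse
  have hcover : (univ.filter fun σ : Config n d m => ¬ lovaszTheta (toGraph σ)ᶜ ≤ θ + 1) ⊆
      (univ.filter fun σ : Config n d m => t ≤ (distTo A hAne σ : ℝ)) ∪
      (univ.filter fun σ : Config n d m => ∃ S : Finset (Fin n), 16 * C * #S ≤ n ∧
        5 * #S < 4 * edgesInside σ S) := by
    intro σ hσ
    by_contra hcon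
    rw [mem_union, not_or, mem_filter, mem_filter] at hcon
    simp only [mem_univ, true_and, not_le, not_exists, not_and, not_lt] at hcon
    obtain ⟨h1, h2⟩ := hcon
    refine (mem_filter.1 hσ).2 ?_
    obtain ⟨τ, hτ, h⟩ := exists_mem_eq_inf' hAne fun τ => #{x | σ x ≠ τ x}
    rw [distTo, h, ht, lt_div_iff₀ (by positivity)] at h1
    have h1' : #{x | σ x ≠ τ x} * (512 * C) < n := by exact_mod_cast h1
    refine lovaszTheta_toGraph_le hθ hn (L := n / (16 * C)) (fun S hS => h2 S ?_)
      (mem_filter.1 hτ).2.2 ?_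
    · rw [Nat.le_div_iff_mul_le (by positivity)] at hS
      linarith
    · rw [Nat.le_div_iff_mul_le (by positivity)]
      nlinarith
  calc (#{σ : Config n d m | ¬ lovaszTheta (toGraph σ)ᶜ ≤ θ + 1} : ℝ)
      ≤ #{σ : Config n d m | t ≤ (distTo A hAne σ : ℝ)} +
        #{σ : Config n d m | ∃ S : Finset (Fin n), 16 * C * #S ≤ n ∧
          5 * #S < 4 * edgesInside σ S} := by
        exact_mod_cast (card_le_card hcover).trans (card_union_le _ _)
    _ ≤ 16 * 2 ^ 2 * (Fintype.card (Fin m × Bool) : ℝ) / t ^ 2 * Fintype.card (Config n d m) +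
        16 * C / n * Fintype.card (Config n d m) := add_le_add hdist hsparse
    _ = _ := by
        rw [hcardα, ht]
        field_simp
        ring

theorem probability_le_one (n d : ℕ) (E : SimpleGraph (Fin n) → Prop) :
    probability n d E ≤ 1 := by
  classical
  rw [probability]
  refine div_le_one_of_le₀ ?_ (Nat.cast_nonneg _)
  exact_mod_cast card_filter_le _ _

theorem probability_nonneg (n d : ℕ) (E : SimpleGraph (Fin n) → Prop) :
    0 ≤ probability n d E := div_nonneg (Nat.cast_nonneg _) (Nat.cast_nonneg _)

theorem withHighProbability_zero {θ : ℝ} (hθ : 3 ≤ θ) :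
    WithHighProbability 0 fun _ G => lovaszTheta Gᶜ ≤ θ + 1 := by
  classical
  refine tendsto_const_nhds.congr fun n => ?_
  have hmem : (⊥ : SimpleGraph (Fin n)) ∈ regularGraphs n 0 := by
    rw [mem_regularGraphs]
    intro v
    simp [SimpleGraph.neighborSet]
  have hall : (regularGraphs n 0).filter (fun G => lovaszTheta Gᶜ ≤ θ + 1) =
      regularGraphs n 0 := by
    refine filter_true_of_mem fun G hG => lovaszTheta_compl_le_of_no_edges hθ fun i j hij => ?_
    rw [mem_regularGraphs] at hG
    have := hG i
    rw [Nat.card_eq_zero] at this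
    rcases this with h | h
    · exact h.elim ⟨j, hij⟩
    · exact h.not_finite (Set.toFinite _)
  rw [probability]
  symm
  convert div_self (a := ((regularGraphs n 0).card : ℝ)) ?_ using 3
  · convert congrArg Finset.card hall
  · exact_mod_cast (card_pos.2 ⟨_, hmem⟩).ne'

theorem exists_le_probability {d : ℕ} {E : ∀ n : ℕ, SimpleGraph (Fin n) → Prop}
    (h : WithPositiveProbability d E) :
    ∃ ε > 0, ∀ᶠ n in admissible d, ε ≤ probability n d (E n) := by
  obtain ⟨ε, h0, h1⟩ := exists_between h
  refine ⟨ε, h0, (eventually_lt_of_lt_liminf h1 ?_).mono fun n hn => hn.le⟩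
  exact isBoundedUnder_of ⟨0, fun n => probability_nonneg n d _⟩

/-- Simple configurations have density at least 1/C, so a proportion ε of them has density at least
ε/C overall, and an exceptional density O(1/n) overall grows by at most the factor C among the
simple ones. -/
theorem one_sub_le_probability {d : ℕ} (hd : 0 < d) {θ ε : ℝ} (hθ : 3 ≤ θ) (hε : 0 < ε) :
    ∃ K : ℝ, ∀ᶠ n in admissible d, ε ≤ probability n d (fun G => lovaszTheta Gᶜ ≤ θ) →
      1 - K / n ≤ probability n d (fun G => lovaszTheta Gᶜ ≤ θ + 1) := by
  classical
  obtain ⟨C, m₀, hC, hsimple⟩ := exists_fraction_simple d hd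
  have hC' : (0 : ℝ) < C := by exact_mod_cast hC
  set Q : ℝ := 64 * d * (512 * (3 ^ 9 * d ^ 5)) ^ 2 with hQ
  refine ⟨(Q + 16 * (3 ^ 9 * d ^ 5)) * C, ?_⟩
  have hev : ∀ᶠ n in admissible d, Even (n * d) := mem_inf_of_right (mem_principal_self _)
  have hbig : ∀ᶠ n : ℕ in admissible d, Q ≤ ε / C * n :=
    ((tendsto_natCast_atTop_atTop.const_mul_atTop (by positivity)).eventually_ge_atTop Q).filter_mono
      inf_le_left
  have hge : ∀ᶠ n : ℕ in admissible d, 2 * m₀ + 64 * (3 ^ 9 * d ^ 5) ≤ n :=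
    (eventually_ge_atTop _).filter_mono inf_le_left
  filter_upwards [hev, hbig, hge] with n heven hnQ hn hprob
  obtain ⟨m, hm⟩ := heven.two_dvd
  have hnd : n ≤ n * d := Nat.le_mul_of_pos_right n hd
  have hCard : 0 < Fintype.card (Config n d m) := by
    refine Fintype.card_pos_iff.2 (Fintype.card_eq.1 ?_)
    simp [hm, mul_comm]
  have hs := hsimple n m (by omega)
  rw [Nat.card_eq_fintype_card, Fintype.card_subtype] at hs
  have hs' : (Fintype.card (Config n d m) : ℝ) ≤ C * #{σ : Config n d m | IsSimple σ} := by
    exact_mod_cast hs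
  have hspos : 0 < #{σ : Config n d m | IsSimple σ} := by
    by_contra h0
    have : #{σ : Config n d m | IsSimple σ} = 0 := by omega
    rw [this] at hs
    omega
  have hspos' : (0 : ℝ) < #{σ : Config n d m | IsSimple σ} := by exact_mod_cast hspos
  obtain ⟨σ₀, hσ₀⟩ := card_pos.1 hspos
  have hne : ∃ σ : Config n d m, IsSimple σ := ⟨σ₀, (mem_filter.1 hσ₀).2⟩
  rw [probability_eq _ hne, le_div_iff₀ hspos'] at hprob
  rw [probability_eq _ hne, le_div_iff₀ hspos']
  have hbad := card_theta_gt_le (c := ε / C) hm hd hθ (by positivity) (by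
      refine le_trans ?_ hprob
      rw [div_mul_eq_mul_div, div_le_iff₀ hC', mul_assoc, mul_comm _ (C : ℝ)]
      gcongr) hCard (by omega) hnQ
  have hsplit : (#{σ : Config n d m | IsSimple σ} : ℝ) ≤
      #{σ : Config n d m | IsSimple σ ∧ lovaszTheta (toGraph σ)ᶜ ≤ θ + 1} +
      #{σ : Config n d m | ¬ lovaszTheta (toGraph σ)ᶜ ≤ θ + 1} := by
    norm_cast
    refine (card_le_card fun σ hσ => ?_).trans (card_union_le _ _)
    simp only [mem_union, mem_filter, mem_univ, true_and] at hσ ⊢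
    by_cases h : lovaszTheta (toGraph σ)ᶜ ≤ θ + 1
    · exact .inl ⟨hσ, h⟩
    · exact .inr h
  have hfin : (Q + 16 * (3 ^ 9 * d ^ 5)) / n * Fintype.card (Config n d m) ≤
      (Q + 16 * (3 ^ 9 * d ^ 5)) * C / n * #{σ : Config n d m | IsSimple σ} := by
    calc _ ≤ (Q + 16 * (3 ^ 9 * d ^ 5)) / n * (C * #{σ : Config n d m | IsSimple σ}) := by
          gcongr
      _ = _ := by ring
  rw [← hQ] at hbad
  rw [sub_mul, one_mul]
  linarith

end Main

end RandomRegular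

end

theorem mainTheorem6 (d : ℕ) (θ : ℝ) (hθ : 3 ≤ θ)
    (hpos : RandomRegular.WithPositiveProbability d
      (fun _ G => RandomRegular.lovaszTheta Gᶜ ≤ θ)) :
    RandomRegular.WithHighProbability d
      (fun _ G => RandomRegular.lovaszTheta Gᶜ ≤ θ + 1) := by
  rcases Nat.eq_zero_or_pos d with rfl | hd
  · exact RandomRegular.withHighProbability_zero hθ
  obtain ⟨ε, hε, hev⟩ := RandomRegular.exists_le_probability hpos
  obtain ⟨K, hK⟩ := RandomRegular.one_sub_le_probability hd hθ hε
  have hlim : Tendsto (fun n : ℕ => 1 - K / n) (RandomRegular.admissible d) (𝓝 1) := by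
    have := (tendsto_const_nhds (x := (1 : ℝ))).sub (tendsto_const_div_atTop_nhds_zero_nat K)
    rw [sub_zero] at this
    exact this.mono_left inf_le_left
  refine tendsto_of_tendsto_of_tendsto_of_le_of_le' hlim tendsto_const_nhds ?_
    (Eventually.of_forall fun n => RandomRegular.probability_le_one n d _)
  filter_upwards [hev, hK] with n h1 h2 using h2 h1
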